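/- Let $D\geq 3$, let $U$ be a vector space of dimension $2D$ over a finite field with $q$ elements, and let $\Gamma=J_q(2D,D)$ be the Grassmann graph: its vertex set $X$ is the set of $D$-dimensional subspaces of $U$, and $x,y\in X$ are adjacent when $\dim(x\cap y)=D-1$. Let $\partial$ denote the path-length distance in $\Gamma$, let $\Gamma_j(x)=\{z\in X:\partial(x,z)=j\}$ and $\Gamma(x)=\Gamma_1(x)$, let $A_j$ be the $0/1$ matrix over $\mathbb R$ indexed by $X$ with $(x,y)$-entry $1$ iff $\partial(x,y)=j$, let $A=A_1$, and let $M=\mathrm{Span}_{\mathbb R}\{A_j : j\ge 0\}$ be the Bose–Mesner algebra. A primitive idempotent of $\Gamma$ is a minimal nonzero idempotent of $M$. Let $$\theta_i=q^{1-i}\Bigl(\frac{q^D-q^i}{q-1}\Bigr)^2-\frac{q^i-1}{q-1}\qquad(0\le i\le D),$$ the eigenvalue sequence of the dual $q$-Hahn $Q$-polynomial structure of $\Gamma$. Then $\Gamma$ has a unique primitive idempotent $E=E_1$ with $AE=\theta_1E$. For $x\in X$ let $\hat x\in\mathbb R^X$ be the corresponding standard basis vector, and for $u,v\in E\,\mathbb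 R^X$ let $u\star v=E(u\circ v)$ be the Norton product, where $\circ$ is the entrywise product. For $x,y\in X$ with $\partial(x,y)=i$ let $$x^-_y=\sum_{z\in\Gamma(x)\cap\Gamma_{i-1}(y)}\hat z,\qquad x^+_y=\sum_{z\in\Gamma(x)\cap\Gamma_{i+1}(y)}\hat z .$$ Then the set $\{E\hat x : x\in X\}$ is Norton-balanced: for all $x,y\in X$ and all $i,j\ge 0$, $$\sum_{z\in\Gamma_i(x)\cap\Gamma_j(y)}E\hat z\in\mathrm{Span}\{E\hat x,\;E\hat y,\;E\hat x\star E\hat y\}.$$ Moreover, let $x,y\in X$ be distinct and $i=\partial(x,y)$. If $2\le i\le D-1$, then $$0=Ex^-_y+\frac{q^{i-1}-1}{q^D-q^i}\,Ex^+_y-\frac{q^{i-1}-1}{q-1}\,\frac{q^D-q}{q-1}\,E\hat x-q^{i-1}E\hat y .$$ If $i=D$, then $$0=Ex^-_y-q\Bigl(\frac{q^{D-1}-1}{q-1}\Bigr)^2E\hat x-q^{D-1}E\hat y .$$ -/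

import Mathlib

/-! ### Distance matrices, the Bose-Mesner algebra and the Norton-balanced condition -/

section AlgebraicGraph

variable {X : Type*} [Fintype X]

/-- The distance matrix `A_i` of `G`: its `(x, y)`-entry is `1` if `∂(x, y) = i` and `0` otherwise.
For a connected graph `A_1` is the adjacency matrix. -/
noncomputable def distanceMatrix (G : SimpleGraph X) (i : ℕ) : Matrix X X ℝ :=
  Matrix.of fun x y => if G.dist x y = i then 1 else 0

/-- The Bose-Mesner algebra of a distance-regular graph, as a subspace of `Mat_X(ℝ)`: the span of
the distance matrices. (For a connected graph, `A_i = 0` when `i` exceeds the diameter.) -/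
def boseMesner (G : SimpleGraph X) : Submodule ℝ (Matrix X X ℝ) :=
  Submodule.span ℝ (Set.range (distanceMatrix G))

/-- A primitive idempotent of the Bose-Mesner algebra: a nonzero idempotent of the algebra which
is minimal, i.e. the only idempotents `F` of the algebra that lie below `E` (`E F = F E = F`) are
`0` and `E`. -/
def IsPrimitiveIdempotent (G : SimpleGraph X) (E : Matrix X X ℝ) : Prop :=
  E ∈ boseMesner G ∧ E ≠ 0 ∧ E * E = E ∧
    ∀ F ∈ boseMesner G, F * F = F → E * F = F → F * E = F → F = 0 ∨ F = E

open Classical in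
/-- The standard basis vector `x̂` of `V = ℝ^X`. -/
noncomputable def hat (x : X) : X → ℝ := Pi.single x 1

/-- The vector `∑ ẑ` over `z ∈ Γ_i(x) ∩ Γ_j(y)`. -/
noncomputable def sphereSum (G : SimpleGraph X) (i j : ℕ) (x y : X) : X → ℝ :=
  ∑ z : X with G.dist x z = i ∧ G.dist y z = j, hat z

/-- The vector `x⁻_y = ∑ ẑ` over `z ∈ Γ(x) ∩ Γ_{i-1}(y)`, where `i = ∂(x, y)`; it is `0` if
`i = 0`. -/
noncomputable def xMinus (G : SimpleGraph X) (x y : X) : X → ℝ :=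
  ∑ z : X with G.dist x z = 1 ∧ G.dist y z + 1 = G.dist x y, hat z

/-- The vector `x⁺_y = ∑ ẑ` over `z ∈ Γ(x) ∩ Γ_{i+1}(y)`, where `i = ∂(x, y)`. -/
noncomputable def xPlus (G : SimpleGraph X) (x y : X) : X → ℝ :=
  ∑ z : X with G.dist x z = 1 ∧ G.dist y z = G.dist x y + 1, hat z

/-- The Norton product `u ⋆ v = E (u ∘ v)`, where `∘` is the entrywise product. -/
noncomputable def nortonProduct (E : Matrix X X ℝ) (u v : X → ℝ) : X → ℝ :=
  E.mulVec (u * v)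

/-- The set `{E x̂ | x ∈ X}` is Norton-balanced: for all vertices `x, y` and all `i, j`, the sum of
`E ẑ` over `z ∈ Γ_i(x) ∩ Γ_j(y)` lies in the span of `E x̂`, `E ŷ`, `E x̂ ⋆ E ŷ`. (For a connected
graph the sum is empty when `i` or `j` exceeds the diameter.) -/
def IsNortonBalanced (G : SimpleGraph X) (E : Matrix X X ℝ) : Prop :=
  ∀ (x y : X) (i j : ℕ),
    E.mulVec (sphereSum G i j x y) ∈
      Submodule.span ℝ {E.mulVec (hat x), E.mulVec (hat y),
        nortonProduct E (E.mulVec (hat x)) (E.mulVec (hat y))}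

end AlgebraicGraph

/-! ### The Grassmann graph -/

/-- The vertices of the Grassmann graph: the `D`-dimensional subspaces of `U`. -/
abbrev GrassmannVertex (K U : Type*) [Field K] [AddCommGroup U] [Module K U] (D : ℕ) :=
  {W : Submodule K U // Module.finrank K W = D}

noncomputable instance grassmannVertexFintype (K U : Type*) [Field K] [Finite K] [AddCommGroup U]
    [Module K U] [FiniteDimensional K U] (D : ℕ) : Fintype (GrassmannVertex K U D) :=
  haveI : Finite U := Module.finite_of_finite K
  Fintype.ofFinite _

/-- The Grassmann graph: distinct `D`-dimensional subspaces of `U` are adjacent when their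
intersection has dimension `D - 1`. If `|K| = q` and `dim U = N`, this is `J_q(N, D)`. -/
def grassmannGraph (K U : Type*) [Field K] [AddCommGroup U] [Module K U] (D : ℕ) :
    SimpleGraph (GrassmannVertex K U D) where
  Adj x y := Module.finrank K ↥(x.1 ⊓ y.1) + 1 = D
  symm := ⟨fun x y h => by rw [inf_comm]; exact h⟩
  loopless := ⟨fun x h => by
    have hx := x.2
    rw [inf_idem] at h
    omega⟩

/-- The eigenvalue sequence `θ_0, θ_1, …, θ_D` of the dual `q`-Hahn `Q`-polynomial structure of
`J_q(2D, D)`. -/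
noncomputable def grassmannEigenvalue (q : ℝ) (D i : ℕ) : ℝ :=
  q ^ (1 - (i : ℤ)) * ((q ^ D - q ^ i) / (q - 1)) * ((q ^ D - q ^ i) / (q - 1))
    - (q ^ i - 1) / (q - 1)

/-! The matrix with entries `q ^ dim (x ⊓ y) - μ` is, for a suitable `μ`, an eigenmatrix of the
Bose-Mesner algebra for `θ₁`. In a connected graph such a matrix is determined by one diagonal
entry, so `E` is a nonzero multiple of it. Hence, up to scaling and an additive constant, `E h`
evaluated at `w` is `∑ z, q ^ dim (w ⊓ z) * h z`. Additive constants do no harm, because the columns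
of `E` sum to zero (`IsCenteredKernel.mulVec_eq_zero`).

Since `q ^ dim (w ⊓ z)` counts the vectors of `w ⊓ z`, this transform is the sum over `u ∈ w` of
`vectorSum h u`, the total of `h` over the vertices through `u`. If `h z` depends only on the
distances from `z` to `x` and to `y`, the stabilizer of the two subspaces in `GL(U)` forces
`vectorSum h` to be constant on five classes of nonzero vectors (`exists_hasClassValues`). The
transform is then a combination of `q ^ dim (w ⊓ t)` for `t = x, y, x ⊓ y, x ⊔ y`, plus a constant
(`HasClassValues.kernelSum_eq`).

That leaves one term too many. A polarity of `U` fixing `x` and `y` exchanges `x ⊓ y` with `x ⊔ y`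
and makes the ratio of their coefficients independent of `h` (`HasClassValues.inf_coeff_eq`).
Besides `E x̂` and `E ŷ` there remains a single direction, and the Norton product has a nonzero
component along it (`HasClassValues.out_lt_sup`). This gives the balanced condition.

For the two explicit relations, the neighbours of `x` closer to and farther from `y` are counted,
and the class values of a weighted neighbour sum are solved for. The weight of `x⁺` is the one for
which the extra direction cancels. At distance `D` that direction is constant anyway, as `x ⊓ y = ⊥`
and `x ⊔ y = ⊤`. -/

open Module

set_option linter.unusedSectionVars false

/-! ### Automorphisms moving vectors, subspaces and pairs of subspaces -/

section LinearAlgebra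

variable {K U U' : Type*} [Field K] [AddCommGroup U] [Module K U] [AddCommGroup U'] [Module K U']

/-- Linear equivalences of complementary pieces glue to a linear equivalence. -/
theorem exists_linearEquiv_of_isCompl {p q : Submodule K U} {p' q' : Submodule K U'}
    (h : IsCompl p q) (h' : IsCompl p' q') (e₁ : p ≃ₗ[K] p') (e₂ : q ≃ₗ[K] q') :
    ∃ e : U ≃ₗ[K] U', (∀ v : p, e v = e₁ v) ∧ ∀ v : q, e v = e₂ v := by
  refine ⟨(p.prodEquivOfIsCompl q h).symm ≪≫ₗ e₁.prodCongr e₂ ≪≫ₗ p'.prodEquivOfIsCompl q' h',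
    fun v => ?_, fun v => ?_⟩
  · simp
  · simp

theorem map_eq_of_forall_mem {e : U ≃ₗ[K] U'} {s : Submodule K U} {s' : Submodule K U'}
    [FiniteDimensional K U'] (h : ∀ v ∈ s, e v ∈ s') (hd : finrank K s = finrank K s') :
    s.map (e : U →ₗ[K] U') = s' := by
  refine Submodule.eq_of_le_of_finrank_eq ?_ ?_
  · rintro _ ⟨v, hv, rfl⟩
    exact h v hv
  · rw [← hd]
    exact e.finrank_map_eq s

theorem finrank_submoduleOf {s t : Submodule K U} (h : s ≤ t) :
    finrank K (s.submoduleOf t) = finrank K s :=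
  (Submodule.submoduleOfEquivOfLe h).finrank_eq

/-- Two vectors outside `t` are both nonzero under some functional vanishing on `t`. -/
theorem exists_dual_eq_one_of_notMem {t : Submodule K U} {u v : U} (hu : u ∉ t) (hv : v ∉ t) :
    ∃ f : U →ₗ[K] K, f u = 1 ∧ f v ≠ 0 ∧ ∀ w ∈ t, f w = 0 := by
  suffices H : ∃ f : U →ₗ[K] K, f u ≠ 0 ∧ f v ≠ 0 ∧ ∀ w ∈ t, f w = 0 by
    obtain ⟨f, h1, h2, h3⟩ := H
    exact ⟨(f u)⁻¹ • f, by simp [h1], by simp [h1, h2], fun w hw => by simp [h3 w hw]⟩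
  obtain ⟨f, hf, hft⟩ := Submodule.exists_le_ker_of_notMem hu
  obtain ⟨g, hg, hgt⟩ := Submodule.exists_le_ker_of_notMem hv
  by_cases hfv : f v = 0
  · by_cases hgu : g u = 0
    · refine ⟨f + g, by simpa [hgu], by simpa [hfv], fun w hw => ?_⟩
      have h1 : f w = 0 := hft hw
      have h2 : g w = 0 := hgt hw
      simp [h1, h2]
    · exact ⟨g, hgu, hg, fun w hw => hgt hw⟩
  · exact ⟨f, hf, hfv, fun w hw => hft hw⟩

/-- Two vectors outside `t` are exchanged by a linear automorphism which fixes `t` pointwise and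
moves every vector by a multiple of the difference. -/
theorem exists_linearEquiv_apply_eq {t : Submodule K U} {u v : U} (hu : u ∉ t) (hv : v ∉ t) :
    ∃ e : U ≃ₗ[K] U, e u = v ∧
      ∀ s : Submodule K U, s ≤ t ∨ v - u ∈ s → ∀ w ∈ s, e w ∈ s := by
  obtain ⟨f, h1, h2, h3⟩ := exists_dual_eq_one_of_notMem hu hv
  -- The map `w ↦ w + f w • (v - u)` is invertible exactly when this scalar is nonzero; as `f u =
  -- 1`, it equals `f v`.
  have h : IsUnit (1 + f (v - u)) := by simpa [h1] using h2
  refine ⟨LinearEquiv.dilatransvection h, ?_, ?_⟩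
  · simp [LinearEquiv.dilatransvection.apply, h1]
  · rintro s (hs | hs) w hw
    · simpa [LinearEquiv.dilatransvection.apply, h3 w (hs hw)]
    · rw [LinearEquiv.dilatransvection.apply]
      exact add_mem hw (s.smul_mem _ hs)

open Classical in
theorem card_filter_mem [Finite K] [Fintype U] (s : Submodule K U) :
    (Finset.univ.filter (· ∈ s)).card = Nat.card K ^ finrank K s := by
  rw [← Module.natCard_eq_pow_finrank (K := K) (V := s), ← Fintype.card_subtype,
    Nat.card_eq_fintype_card]

variable [FiniteDimensional K U] [FiniteDimensional K U']

/-- Subspaces of the same dimension are equivalent. -/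
theorem exists_linearEquiv_map_eq (hU : finrank K U = finrank K U') (s : Submodule K U)
    (s' : Submodule K U') (hs : finrank K s = finrank K s') :
    ∃ e : U ≃ₗ[K] U', ∀ v ∈ s, e v ∈ s' := by
  obtain ⟨c, hc⟩ := s.exists_isCompl
  obtain ⟨c', hc'⟩ := s'.exists_isCompl
  have h1 := Submodule.finrank_add_eq_of_isCompl hc
  have h2 := Submodule.finrank_add_eq_of_isCompl hc'
  obtain ⟨e, he, -⟩ := exists_linearEquiv_of_isCompl hc hc' (LinearEquiv.ofFinrankEq _ _ hs)
    (LinearEquiv.ofFinrankEq _ _ (by omega))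
  exact ⟨e, fun v hv => by rw [he ⟨v, hv⟩]; exact Subtype.coe_prop _⟩

/-- Two subspaces `x`, `y` can be split along a complement of `x`. -/
theorem exists_isCompl_split (x y : Submodule K U) :
    ∃ b c : Submodule K U, b ≤ c ∧ IsCompl x c ∧ (x ⊓ y) ⊔ b = y ∧
      finrank K ↥(x ⊓ y) + finrank K b = finrank K y := by
  obtain ⟨b, hb, hb'⟩ := IsModularLattice.exists_disjoint_and_sup_eq (inf_le_right : x ⊓ y ≤ y)
  have hby : b ≤ y := hb' ▸ le_sup_right
  have hd : Disjoint b x := by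
    rw [disjoint_iff_inf_le]
    intro v hv
    exact hb.le_bot ⟨⟨hv.2, hby hv.1⟩, hv.1⟩
  obtain ⟨c, hbc, hc⟩ := hd.exists_isCompl
  refine ⟨b, c, hbc, hc.symm, hb', ?_⟩
  have := Submodule.finrank_sup_add_finrank_inf_eq (x ⊓ y) b
  rw [hb', hb.eq_bot, finrank_bot] at this
  omega

/-- Pairs of subspaces are classified by the dimensions of the subspaces and of their
intersection. -/
theorem exists_linearEquiv_map_pair (hU : finrank K U = finrank K U')
    (x y : Submodule K U) (x' y' : Submodule K U')
    (hx : finrank K x = finrank K x') (hy : finrank K y = finrank K y')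
    (hxy : finrank K ↥(x ⊓ y) = finrank K ↥(x' ⊓ y')) :
    ∃ e : U ≃ₗ[K] U', x.map (e : U →ₗ[K] U') = x' ∧ y.map (e : U →ₗ[K] U') = y' := by
  obtain ⟨b, c, hbc, hc, hb, hbd⟩ := exists_isCompl_split x y
  obtain ⟨b', c', hbc', hc', hb', hbd'⟩ := exists_isCompl_split x' y'
  have h1 := Submodule.finrank_add_eq_of_isCompl hc
  have h2 := Submodule.finrank_add_eq_of_isCompl hc'
  obtain ⟨e₁, he₁⟩ := exists_linearEquiv_map_eq hx ((x ⊓ y).submoduleOf x)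
    ((x' ⊓ y').submoduleOf x') (by
      rw [finrank_submoduleOf inf_le_left, finrank_submoduleOf inf_le_left, hxy])
  obtain ⟨e₂, he₂⟩ := exists_linearEquiv_map_eq (by omega : finrank K c = finrank K c')
    (b.submoduleOf c) (b'.submoduleOf c') (by
      rw [finrank_submoduleOf hbc, finrank_submoduleOf hbc']; omega)
  obtain ⟨e, h₁, h₂⟩ := exists_linearEquiv_of_isCompl hc hc' e₁ e₂
  refine ⟨e, map_eq_of_forall_mem (fun v hv => ?_) hx, map_eq_of_forall_mem (fun v hv => ?_) hy⟩
  · rw [h₁ ⟨v, hv⟩]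
    exact Subtype.coe_prop _
  · rw [← hb] at hv
    obtain ⟨m, hm, n, hn, rfl⟩ := Submodule.mem_sup.1 hv
    rw [map_add]
    refine add_mem ?_ ?_
    · rw [h₁ ⟨m, hm.1⟩]
      exact (he₁ ⟨m, hm.1⟩ hm).2
    · rw [h₂ ⟨n, hbc hn⟩, ← hb']
      exact Submodule.mem_sup_right (he₂ ⟨n, hbc hn⟩ hn)

end LinearAlgebra

/-! ### Dimension formulas and polarities -/

section FiniteDimensional

variable {K U : Type*} [Field K] [AddCommGroup U] [Module K U] [FiniteDimensional K U]

theorem finrank_sup_add_inf (s t : Submodule K U) :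
    finrank K ↥(s ⊔ t) + finrank K ↥(s ⊓ t) = finrank K s + finrank K t :=
  Submodule.finrank_sup_add_finrank_inf_eq s t

theorem finrank_le_of_le {s t : Submodule K U} (h : s ≤ t) : finrank K s ≤ finrank K t :=
  Submodule.finrank_mono h

theorem finrank_sup_span_singleton {s : Submodule K U} {v : U} (hv : v ∉ s) :
    finrank K ↥(s ⊔ Submodule.span K {v}) = finrank K s + 1 := by
  have h0 : v ≠ 0 := fun h => hv (h ▸ s.zero_mem)
  have h := finrank_sup_add_inf s (Submodule.span K {v})
  have hd : s ⊓ Submodule.span K {v} = ⊥ := by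
    rw [← disjoint_iff, Submodule.disjoint_span_singleton' h0]
    exact hv
  rw [hd, finrank_bot, finrank_span_singleton h0] at h
  exact h

/-- Two subspaces of half the dimension are simultaneously fixed by an anti-automorphism of the
subspace lattice. -/
theorem exists_polarity {D : ℕ} (hU : finrank K U = 2 * D) {x y : Submodule K U}
    (hx : finrank K x = D) (hy : finrank K y = D) :
    ∃ σ : Submodule K U → Submodule K U, Function.Injective σ ∧
      (∀ s t, σ (s ⊔ t) = σ s ⊓ σ t) ∧ (∀ s t, σ (s ⊓ t) = σ s ⊔ σ t) ∧
      (∀ s, finrank K (σ s) + finrank K s = 2 * D) ∧ σ x = x ∧ σ y = y := by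
  have hxa := Subspace.finrank_add_finrank_dualAnnihilator_eq x
  have hya := Subspace.finrank_add_finrank_dualAnnihilator_eq y
  have hxya := Subspace.finrank_add_finrank_dualAnnihilator_eq (x ⊔ y)
  have hs := finrank_sup_add_inf x y
  -- The pairs `(x, y)` and `(x°, y°)` of annihilators have the same dimensions: `x° ⊓ y° = (x ⊔
  -- y)°` has dimension `2D - dim (x ⊔ y) = dim (x ⊓ y)`. The polarity sends `s` to the preimage of
  -- `s°` under `e`.
  obtain ⟨e, hex, hey⟩ := exists_linearEquiv_map_pair (U' := Dual K U)
    (Subspace.dual_finrank_eq (K := K) (V := U)).symm x y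
    x.dualAnnihilator y.dualAnnihilator (by omega) (by omega)
    (by rw [← Submodule.dualAnnihilator_sup_eq]; omega)
  refine ⟨fun s => s.dualAnnihilator.map (e.symm : Dual K U →ₗ[K] U), ?_, ?_, ?_, ?_, ?_, ?_⟩
  · intro s t h
    exact Subspace.dualAnnihilator_inj.1 (Submodule.map_injective_of_injective e.symm.injective h)
  · intro s t
    simp only [Submodule.dualAnnihilator_sup_eq]
    exact Submodule.map_inf _ e.symm.injective
  · intro s t
    simp only [Subspace.dualAnnihilator_inf_eq, Submodule.map_sup]
  · intro s
    have := Subspace.finrank_add_finrank_dualAnnihilator_eq s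
    have h2 : finrank K (s.dualAnnihilator.map (e.symm : Dual K U →ₗ[K] U)) =
      finrank K s.dualAnnihilator := e.symm.finrank_map_eq _
    simp only [h2]
    omega
  · simp only [← hex]
    ext v
    simp
  · simp only [← hey]
    ext v
    simp

end FiniteDimensional

/-! ### Neighbours and distance in the Grassmann graph -/

section GrassmannDistance

variable {K U : Type*} [Field K] [AddCommGroup U] [Module K U] {D : ℕ}

theorem grassmannGraph_adj {x y : GrassmannVertex K U D} :
    (grassmannGraph K U D).Adj x y ↔ finrank K ↥(x.1 ⊓ y.1) + 1 = D :=
  Iff.rfl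

theorem grassmannGraph_dist_eq_one {x y : GrassmannVertex K U D} :
    (grassmannGraph K U D).dist x y = 1 ↔ finrank K ↥(x.1 ⊓ y.1) + 1 = D := by
  rw [SimpleGraph.dist_eq_one_iff_adj, grassmannGraph_adj]

variable [FiniteDimensional K U]

theorem finrank_inf_ker_add_one {s : Submodule K U} {f : Dual K U} (hf : f ∉ s.dualAnnihilator) :
    finrank K ↥(s ⊓ LinearMap.ker f) + 1 = finrank K s := by
  have h0 : f ≠ 0 := fun h => hf (h ▸ zero_mem _)
  have h1 := Dual.finrank_ker_add_one_of_ne_zero h0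
  have h2 := finrank_sup_add_inf s (LinearMap.ker f)
  have h3 : finrank K ↥(s ⊔ LinearMap.ker f) ≤ finrank K U := Submodule.finrank_le _
  have h4 : LinearMap.ker f < s ⊔ LinearMap.ker f := by
    refine lt_of_le_of_ne le_sup_right fun h => hf ?_
    rw [Submodule.mem_dualAnnihilator]
    intro w hw
    have : w ∈ LinearMap.ker f := h ▸ Submodule.mem_sup_left hw
    exact this
  have h5 := Submodule.finrank_lt_finrank_of_lt h4
  omega

/-- A hyperplane of `x`, cut out by a functional, and a vector outside `x` span a unique
neighbour of `x`. -/
theorem existsUnique_neighbor (x : GrassmannVertex K U D) {f : Dual K U}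
    (hf : f ∉ x.1.dualAnnihilator) {v : U} (hv : v ∉ x.1) :
    ∃! z : GrassmannVertex K U D, x.1 ⊓ z.1 = x.1 ⊓ LinearMap.ker f ∧ v ∈ z.1 := by
  have h1 := finrank_inf_ker_add_one hf
  have hv' : v ∉ x.1 ⊓ LinearMap.ker f := fun h => hv h.1
  have h2 := finrank_sup_span_singleton hv'
  have hxD := x.2
  have hvz : v ∈ (x.1 ⊓ LinearMap.ker f) ⊔ Submodule.span K {v} :=
    Submodule.mem_sup_right (Submodule.mem_span_singleton_self v)
  refine ⟨⟨(x.1 ⊓ LinearMap.ker f) ⊔ Submodule.span K {v}, by omega⟩, ⟨?_, hvz⟩, ?_⟩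
  · symm
    refine Submodule.eq_of_le_of_finrank_le (le_inf inf_le_left le_sup_left) ?_
    have h3 : x.1 ⊓ ((x.1 ⊓ LinearMap.ker f) ⊔ Submodule.span K {v}) <
        (x.1 ⊓ LinearMap.ker f) ⊔ Submodule.span K {v} :=
      lt_of_le_of_ne inf_le_right fun h => hv (h.symm ▸ hvz : v ∈ x.1 ⊓ _).1
    have h4 := Submodule.finrank_lt_finrank_of_lt h3
    simp only
    omega
  · rintro z ⟨hz, hvz'⟩
    have hz2 := z.2
    refine Subtype.ext (Submodule.eq_of_le_of_finrank_eq ?_ (by simp only; omega)).symm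
    refine sup_le ?_ ?_
    · rw [← hz]
      exact inf_le_right
    · rwa [Submodule.span_singleton_le_iff_mem]

/-- The hyperplane `x ⊓ z` of `x` cuts the dimension of `x ⊓ s` by at most one, and what is left
lies in `z`. Along a walk this bounds distances from below. -/
theorem finrank_inf_le_of_adj {x z : GrassmannVertex K U D} (s : Submodule K U)
    (h : (grassmannGraph K U D).Adj x z) :
    finrank K ↥(x.1 ⊓ s) ≤ finrank K ↥(z.1 ⊓ s) + 1 := by
  rw [grassmannGraph_adj] at h
  have h1 := finrank_sup_add_inf (x.1 ⊓ s) (x.1 ⊓ z.1)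
  have h2 := finrank_le_of_le (sup_le inf_le_left inf_le_left : (x.1 ⊓ s) ⊔ (x.1 ⊓ z.1) ≤ x.1)
  have h3 : finrank K ↥((x.1 ⊓ s) ⊓ (x.1 ⊓ z.1)) ≤ finrank K ↥(z.1 ⊓ s) :=
    finrank_le_of_le fun v hv => ⟨hv.2.2, hv.1.2⟩
  have := x.2
  omega

theorem le_finrank_inf_add_length {x y : GrassmannVertex K U D}
    (p : (grassmannGraph K U D).Walk x y) : D ≤ finrank K ↥(x.1 ⊓ y.1) + p.length := by
  induction p with
  | nil =>
    rename_i x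
    rw [inf_idem, x.2, SimpleGraph.Walk.length_nil]
    omega
  | @cons _ _ w h p ih =>
    have := finrank_inf_le_of_adj w.1 h.symm
    rw [SimpleGraph.Walk.length_cons]
    omega

theorem vertex_eq_of_finrank_inf {x y : GrassmannVertex K U D}
    (h : finrank K ↥(x.1 ⊓ y.1) = D) : x = y := by
  have hx := x.2
  have hy := y.2
  have h1 : x.1 ⊓ y.1 = x.1 := Submodule.eq_of_le_of_finrank_eq inf_le_left (by omega)
  have h2 : x.1 ⊓ y.1 = y.1 := Submodule.eq_of_le_of_finrank_eq inf_le_right (by omega)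
  exact Subtype.ext (h1.symm.trans h2)

theorem finrank_inf_le (x y : GrassmannVertex K U D) : finrank K ↥(x.1 ⊓ y.1) ≤ D :=
  (finrank_le_of_le inf_le_left).trans_eq x.2

theorem exists_mem_notMem {x y : GrassmannVertex K U D} (h : x ≠ y) : ∃ v ∈ y.1, v ∉ x.1 := by
  by_contra! H
  have hx := x.2
  have hy := y.2
  exact h (Subtype.ext (Submodule.eq_of_le_of_finrank_eq H (by omega)).symm)

/-- One step of a geodesic: keep a hyperplane of `x` containing `x ⊓ y` and adjoin a vector of `y`
outside `x`. -/
theorem exists_adj_finrank_inf_eq {x y : GrassmannVertex K U D} (h : x ≠ y) :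
    ∃ z, (grassmannGraph K U D).Adj x z ∧ finrank K ↥(z.1 ⊓ y.1) = finrank K ↥(x.1 ⊓ y.1) + 1 := by
  obtain ⟨v, hvy, hvx⟩ := exists_mem_notMem h
  obtain ⟨w, hwx, hwy⟩ := exists_mem_notMem h.symm
  obtain ⟨f, hf, hfy⟩ := Submodule.exists_le_ker_of_notMem hwy
  have hfx : f ∉ x.1.dualAnnihilator := fun H => hf ((Submodule.mem_dualAnnihilator f).1 H w hwx)
  obtain ⟨z, ⟨hz, hvz⟩, -⟩ := existsUnique_neighbor x hfx hvx
  have h1 := finrank_inf_ker_add_one hfx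
  have hadj : (grassmannGraph K U D).Adj x z := by
    rw [grassmannGraph_adj, hz, h1, x.2]
  refine ⟨z, hadj, ?_⟩
  have h2 := finrank_inf_le_of_adj y.1 hadj.symm
  have h3 : x.1 ⊓ y.1 < z.1 ⊓ y.1 := by
    refine lt_of_le_of_ne (le_inf ?_ inf_le_right) fun H => ?_
    · intro u hu
      have : u ∈ x.1 ⊓ z.1 := hz ▸ ⟨hu.1, hfy hu.2⟩
      exact this.2
    · have : v ∈ x.1 ⊓ y.1 := H ▸ ⟨hvz, hvy⟩
      exact hvx this.1
  have h4 := Submodule.finrank_lt_finrank_of_lt h3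
  omega

theorem exists_walk_length_eq (n : ℕ) (x y : GrassmannVertex K U D)
    (h : finrank K ↥(x.1 ⊓ y.1) + n = D) :
    ∃ p : (grassmannGraph K U D).Walk x y, p.length = n := by
  induction n generalizing x with
  | zero =>
    obtain rfl := vertex_eq_of_finrank_inf h
    exact ⟨.nil, rfl⟩
  | succ n ih =>
    have hxy : x ≠ y := by
      rintro rfl
      have := x.2
      rw [inf_idem] at h
      omega
    obtain ⟨z, hz, hzy⟩ := exists_adj_finrank_inf_eq hxy
    obtain ⟨p, hp⟩ := ih z (by omega)
    exact ⟨.cons hz p, by simp [hp]⟩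

/-- The distance in the Grassmann graph is the codimension of the intersection. -/
theorem grassmannGraph_dist_add (x y : GrassmannVertex K U D) :
    (grassmannGraph K U D).dist x y + finrank K ↥(x.1 ⊓ y.1) = D := by
  have hle := finrank_inf_le x y
  obtain ⟨p, hp⟩ := exists_walk_length_eq (D - finrank K ↥(x.1 ⊓ y.1)) x y (by omega)
  have h1 := SimpleGraph.dist_le p
  obtain ⟨p', hp'⟩ := p.reachable.exists_walk_length_eq_dist
  have h2 := le_finrank_inf_add_length p'
  omega

end GrassmannDistance

/-! ### Sums over vertices through a vector, and their class values -/

section VectorSums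

variable {K U : Type*} [Field K] [Finite K] [AddCommGroup U] [Module K U] [FiniteDimensional K U]
  {D : ℕ}

open Classical in
/-- The sum of `h z` over the vertices `z` containing the vector `u`. -/
noncomputable def vectorSum (h : GrassmannVertex K U D → ℝ) (u : U) : ℝ :=
  ∑ z, if u ∈ z.1 then h z else 0

/-- The sum of `h z` weighted by the number of vectors in `s ⊓ z`. -/
noncomputable def kernelSum (h : GrassmannVertex K U D → ℝ) (s : Submodule K U) : ℝ :=
  ∑ z, (Nat.card K : ℝ) ^ finrank K ↥(s ⊓ z.1) * h z

/-- A function of the distances to `x` and to `y`. -/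
noncomputable def biradial (F : ℕ → ℕ → ℝ) (x y z : GrassmannVertex K U D) : ℝ :=
  F (finrank K ↥(x.1 ⊓ z.1)) (finrank K ↥(y.1 ⊓ z.1))

open Classical in
theorem sum_ite_mem [Fintype U] (s : Submodule K U) :
    ∑ u : U, (if u ∈ s then (1 : ℝ) else 0) = (Nat.card K : ℝ) ^ finrank K s := by
  rw [Finset.sum_boole, card_filter_mem, Nat.cast_pow]

open Classical in
theorem sum_ite_mem_const [Fintype U] (s : Submodule K U) (c : ℝ) :
    ∑ u : U, (if u ∈ s then c else 0) = c * (Nat.card K : ℝ) ^ finrank K s := by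
  rw [← sum_ite_mem, Finset.mul_sum]
  simp

open Classical in
-- Double counting of the pairs `u ∈ s ⊓ z`, since the weight `q ^ dim (s ⊓ z)` is the number of
-- such `u`.
theorem kernelSum_eq [Fintype U] (h : GrassmannVertex K U D → ℝ) (s : Submodule K U) :
    kernelSum h s = ∑ u : U, if u ∈ s then vectorSum h u else 0 := by
  simp only [kernelSum, vectorSum, ← sum_ite_mem, Finset.sum_mul, ← Finset.sum_filter]
  rw [Finset.sum_comm' (t' := Finset.univ) (s' := fun z => Finset.univ.filter (· ∈ s ⊓ z.1))]
  · simp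
  · simp

/-- The action of linear automorphisms on the vertices. -/
noncomputable def vertexEquiv (D : ℕ) (e : U ≃ₗ[K] U) :
    GrassmannVertex K U D ≃ GrassmannVertex K U D where
  toFun z := ⟨z.1.map (e : U →ₗ[K] U), (e.finrank_map_eq z.1).trans z.2⟩
  invFun z := ⟨z.1.map (e.symm : U →ₗ[K] U), (e.symm.finrank_map_eq z.1).trans z.2⟩
  left_inv z := by
    ext v
    simp
  right_inv z := by
    ext v
    simp

theorem finrank_inf_map (e : U ≃ₗ[K] U) (s t : Submodule K U) :
    finrank K ↥(s.map (e : U →ₗ[K] U) ⊓ t.map (e : U →ₗ[K] U)) = finrank K ↥(s ⊓ t) := by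
  rw [← Submodule.map_inf _ e.injective]
  exact e.finrank_map_eq _

theorem vectorSum_biradial_apply (F : ℕ → ℕ → ℝ) {x y : GrassmannVertex K U D} (e : U ≃ₗ[K] U)
    (hx : x.1.map (e : U →ₗ[K] U) = x.1) (hy : y.1.map (e : U →ₗ[K] U) = y.1) (u : U) :
    vectorSum (biradial F x y) (e u) = vectorSum (biradial F x y) u := by
  refine (Fintype.sum_equiv (vertexEquiv D e) _ _ fun z => ?_).symm
  have h1 : finrank K ↥(x.1 ⊓ z.1.map (e : U →ₗ[K] U)) = finrank K ↥(x.1 ⊓ z.1) := by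
    conv_lhs => rw [← hx]
    exact finrank_inf_map e _ _
  have h2 : finrank K ↥(y.1 ⊓ z.1.map (e : U →ₗ[K] U)) = finrank K ↥(y.1 ⊓ z.1) := by
    conv_lhs => rw [← hy]
    exact finrank_inf_map e _ _
  classical
  have h3 : (e u ∈ z.1.map (e : U →ₗ[K] U)) = (u ∈ z.1) := by simp
  change (if u ∈ z.1 then F _ _ else 0) = if e u ∈ z.1.map (e : U →ₗ[K] U) then
    F (finrank K ↥(x.1 ⊓ z.1.map (e : U →ₗ[K] U))) (finrank K ↥(y.1 ⊓ z.1.map (e : U →ₗ[K] U)))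
    else 0
  rw [h1, h2]
  simp only [h3]

/-- Vectors which are exchanged by an automorphism fixing `x` and `y` have the same sums. -/
theorem vectorSum_biradial_eq (F : ℕ → ℕ → ℝ) {x y : GrassmannVertex K U D} {t : Submodule K U}
    {u v : U} (hu : u ∉ t) (hv : v ∉ t) (hx : x.1 ≤ t ∨ v - u ∈ x.1) (hy : y.1 ≤ t ∨ v - u ∈ y.1) :
    vectorSum (biradial F x y) u = vectorSum (biradial F x y) v := by
  obtain ⟨e, rfl, he⟩ := exists_linearEquiv_apply_eq hu hv
  exact (vectorSum_biradial_apply F e (map_eq_of_forall_mem (he _ hx) rfl)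
    (map_eq_of_forall_mem (he _ hy) rfl) u).symm

/-- `f` takes the values `m`, `a`, `b`, `s`, `o` on the nonzero vectors of `x ⊓ y`, on `x \ y`, on
`y \ x`, on the rest of `x ⊔ y`, and outside `x ⊔ y`. -/
structure HasClassValues (x y : Submodule K U) (f : U → ℝ) (m a b s o : ℝ) : Prop where
  inf : ∀ u ∈ x, u ∈ y → u ≠ 0 → f u = m
  left : ∀ u ∈ x, u ∉ y → f u = a
  right : ∀ u ∈ y, u ∉ x → f u = b
  sup : ∀ u ∈ x ⊔ y, u ∉ x → u ∉ y → f u = s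
  out : ∀ u ∉ x ⊔ y, f u = o

theorem exists_const_of_forall_eq {α : Type*} {p : α → Prop} {f : α → ℝ}
    (h : ∀ u v, p u → p v → f u = f v) : ∃ c, ∀ u, p u → f u = c := by
  by_cases hp : ∃ u, p u
  · obtain ⟨u, hu⟩ := hp
    exact ⟨f u, fun v hv => h v u hv hu⟩
  · exact ⟨0, fun u hu => (hp ⟨u, hu⟩).elim⟩

/-- The five classes lie within orbits of the stabilizer of `x` and `y`, as dilatransvections along
`v - u` show. The zero vector is left out, so its value enters later as a separate constant. -/
theorem exists_hasClassValues (F : ℕ → ℕ → ℝ) (x y : GrassmannVertex K U D) :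
    ∃ m a b s o, HasClassValues x.1 y.1 (vectorSum (biradial F x y)) m a b s o := by
  obtain ⟨m, hm⟩ := exists_const_of_forall_eq (p := fun u => u ∈ x.1 ∧ u ∈ y.1 ∧ u ≠ 0)
    (f := vectorSum (biradial F x y)) fun u v hu hv =>
      vectorSum_biradial_eq F (t := ⊥) (by simpa using hu.2.2) (by simpa using hv.2.2)
        (.inr (sub_mem hv.1 hu.1)) (.inr (sub_mem hv.2.1 hu.2.1))
  obtain ⟨a, ha⟩ := exists_const_of_forall_eq (p := fun u => u ∈ x.1 ∧ u ∉ y.1)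
    (f := vectorSum (biradial F x y)) fun u v hu hv =>
      vectorSum_biradial_eq F hu.2 hv.2 (.inr (sub_mem hv.1 hu.1)) (.inl le_rfl)
  obtain ⟨b, hb⟩ := exists_const_of_forall_eq (p := fun u => u ∈ y.1 ∧ u ∉ x.1)
    (f := vectorSum (biradial F x y)) fun u v hu hv =>
      vectorSum_biradial_eq F hu.2 hv.2 (.inl le_rfl) (.inr (sub_mem hv.1 hu.1))
  obtain ⟨o, ho⟩ := exists_const_of_forall_eq (p := fun u => u ∉ x.1 ⊔ y.1)
    (f := vectorSum (biradial F x y)) fun u v hu hv =>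
      vectorSum_biradial_eq F hu hv (.inl le_sup_left) (.inl le_sup_right)
  obtain ⟨s, hs⟩ := exists_const_of_forall_eq
    (p := fun u => u ∈ x.1 ⊔ y.1 ∧ u ∉ x.1 ∧ u ∉ y.1)
    (f := vectorSum (biradial F x y)) fun u v hu hv => by
      obtain ⟨⟨c, hc, d, hd, rfl⟩, hux, huy⟩ := Submodule.mem_sup.1 hu.1, hu.2
      obtain ⟨⟨c', hc', d', hd', rfl⟩, hvx, hvy⟩ := Submodule.mem_sup.1 hv.1, hv.2
      rw [add_mem_cancel_left hc] at hux
      rw [add_mem_cancel_right hd] at huy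
      rw [add_mem_cancel_left hc'] at hvx
      rw [add_mem_cancel_right hd'] at hvy
      -- Pass through `c' + d`: first change the `x`-component while fixing `y` pointwise, then the
      -- `y`-component while fixing `x` pointwise.
      refine (vectorSum_biradial_eq F (v := c' + d) (t := y.1) ?_ ?_ (.inr ?_)
        (.inl le_rfl)).trans (vectorSum_biradial_eq F (t := x.1) ?_ ?_ (.inl le_rfl) (.inr ?_))
      · rwa [add_mem_cancel_right hd]
      · rwa [add_mem_cancel_right hd]
      · rw [add_sub_add_right_eq_sub]
        exact sub_mem hc' hc
      · rwa [add_mem_cancel_left hc']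
      · rwa [add_mem_cancel_left hc']
      · rw [add_sub_add_left_eq_sub]
        exact sub_mem hd' hd
  exact ⟨m, a, b, s, o, fun u h1 h2 h3 => hm u ⟨h1, h2, h3⟩, fun u h1 h2 => ha u ⟨h1, h2⟩,
    fun u h1 h2 => hb u ⟨h1, h2⟩, fun u h1 h2 h3 => hs u ⟨h1, h2, h3⟩, fun u h => ho u h⟩

open Classical in
-- Inclusion-exclusion over the lattice generated by `x` and `y`. Indicators of subspaces are wanted
-- because their sums over `w` are powers of `q`; the last term corrects the value at zero.
theorem HasClassValues.eq {x y : Submodule K U} {f : U → ℝ} {m a b s o : ℝ}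
    (h : HasClassValues x y f m a b s o) (u : U) :
    f u = (if u ∈ x then a - s else 0) + (if u ∈ y then b - s else 0)
      + (if u ∈ x ⊓ y then m - a - b + s else 0) + (if u ∈ x ⊔ y then s - o else 0) + o
      + (if u = 0 then f 0 - m else 0) := by
  by_cases h0 : u = 0
  · subst h0
    simp
    ring
  by_cases hx : u ∈ x
  · have hs := Submodule.mem_sup_left (T := y) hx
    by_cases hy : u ∈ y
    · simp [h0, hx, hy, hs, h.inf u hx hy h0]
      ring
    · simp [h0, hx, hy, hs, h.left u hx hy]
  · by_cases hy : u ∈ y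
    · have hs := Submodule.mem_sup_right (S := x) hy
      simp [h0, hx, hy, hs, h.right u hy hx]
    · by_cases hs : u ∈ x ⊔ y
      · simp [h0, hx, hy, hs, h.sup u hs hx hy]
      · simp [h0, hx, hy, hs, h.out u hs]

open Classical in
theorem HasClassValues.sum_eq [Fintype U] {x y : Submodule K U} {f : U → ℝ} {m a b s o : ℝ}
    (h : HasClassValues x y f m a b s o) (w : Submodule K U) :
    ∑ u : U, (if u ∈ w then f u else 0) =
      (a - s) * (Nat.card K : ℝ) ^ finrank K ↥(w ⊓ x)
      + (b - s) * (Nat.card K : ℝ) ^ finrank K ↥(w ⊓ y)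
      + (m - a - b + s) * (Nat.card K : ℝ) ^ finrank K ↥(w ⊓ (x ⊓ y))
      + (s - o) * (Nat.card K : ℝ) ^ finrank K ↥(w ⊓ (x ⊔ y))
      + o * (Nat.card K : ℝ) ^ finrank K w + (f 0 - m) := by
  have hz : ∑ u : U, (if u = 0 then f 0 - m else 0) = f 0 - m := by simp
  rw [← hz]
  simp only [← sum_ite_mem_const, ← Finset.sum_add_distrib]
  refine Finset.sum_congr rfl fun u _ => ?_
  by_cases hw : u ∈ w
  · rw [if_pos hw, h.eq u]
    simp [hw]
  · have h0 : u ≠ 0 := fun h0 => hw (h0 ▸ w.zero_mem)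
    simp [hw, h0]

theorem HasClassValues.kernelSum_eq {h : GrassmannVertex K U D → ℝ} {x y : Submodule K U}
    {m a b s o : ℝ} (H : HasClassValues x y (vectorSum h) m a b s o) (w : Submodule K U) :
    kernelSum h w =
      (a - s) * (Nat.card K : ℝ) ^ finrank K ↥(w ⊓ x)
      + (b - s) * (Nat.card K : ℝ) ^ finrank K ↥(w ⊓ y)
      + (m - a - b + s) * (Nat.card K : ℝ) ^ finrank K ↥(w ⊓ (x ⊓ y))
      + (s - o) * (Nat.card K : ℝ) ^ finrank K ↥(w ⊓ (x ⊔ y))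
      + o * (Nat.card K : ℝ) ^ finrank K w + (vectorSum h 0 - m) := by
  have : Finite U := Module.finite_of_finite K
  let _ := Fintype.ofFinite U
  rw [_root_.kernelSum_eq, H.sum_eq]

end VectorSums

/-! ### Duality between the meet and the join coefficients -/

section Polarity

variable {K U : Type*} [Field K] [Finite K] [AddCommGroup U] [Module K U] [FiniteDimensional K U]
  {D : ℕ}

theorem one_lt_card_real (K : Type*) [Field K] [Finite K] : (1 : ℝ) < Nat.card K := by
  exact_mod_cast Finite.one_lt_card

theorem exists_between_finrank_eq {s t : Submodule K U} (hst : s ≤ t) {n : ℕ}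
    (hs : finrank K s ≤ n) (ht : n ≤ finrank K t) :
    ∃ r : Submodule K U, s ≤ r ∧ r ≤ t ∧ finrank K r = n := by
  induction n, hs using Nat.le_induction with
  | base => exact ⟨s, le_rfl, hst, rfl⟩
  | succ n _ ih =>
    obtain ⟨r, hsr, hrt, hr⟩ := ih (by omega)
    have hlt : r < t := lt_of_le_of_ne hrt fun h => by
      rw [← h] at ht
      omega
    obtain ⟨v, hvt, hvr⟩ := SetLike.exists_of_lt hlt
    refine ⟨r ⊔ Submodule.span K {v}, hsr.trans le_sup_left, sup_le hrt ?_, ?_⟩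
    · rwa [Submodule.span_singleton_le_iff_mem]
    · rw [finrank_sup_span_singleton hvr, hr]

/-- A test vertex for the polarity argument: it meets `x ⊓ y` nontrivially, and the second condition
says that it spans `U` together with `x ⊔ y`. It is the sum of a subspace of `x` through a nonzero
vector of `x ⊓ y` and a complement of `x ⊔ y`. -/
theorem exists_vertex_inf_sup (hU : finrank K U = 2 * D) (x y : GrassmannVertex K U D)
    (h0 : 0 < finrank K ↥(x.1 ⊓ y.1)) (h1 : finrank K ↥(x.1 ⊓ y.1) < D) :
    ∃ w : GrassmannVertex K U D, 0 < finrank K ↥(w.1 ⊓ (x.1 ⊓ y.1)) ∧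
      finrank K ↥(w.1 ⊓ (x.1 ⊔ y.1)) + finrank K ↥(x.1 ⊓ y.1) = D := by
  have hx := x.2
  have hy := y.2
  obtain ⟨e, he⟩ := (finrank_pos_iff_exists_ne_zero (R := K)).1 h0
  have he' : (e : U) ≠ 0 := fun h => he (Subtype.ext h)
  obtain ⟨t, het, htx, ht⟩ := exists_between_finrank_eq (s := Submodule.span K {(e : U)})
    (t := x.1) (n := D - finrank K ↥(x.1 ⊓ y.1))
    (by rw [Submodule.span_singleton_le_iff_mem]; exact e.2.1)
    (by rw [finrank_span_singleton he']; omega) (by omega)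
  rw [Submodule.span_singleton_le_iff_mem] at het
  obtain ⟨c, hc⟩ := (x.1 ⊔ y.1).exists_isCompl
  have h2 := Submodule.finrank_add_eq_of_isCompl hc
  have h3 := finrank_sup_add_inf x.1 y.1
  have h4 := finrank_sup_add_inf t c
  have htp : t ≤ x.1 ⊔ y.1 := htx.trans le_sup_left
  have h5 : t ⊓ c = ⊥ := (hc.disjoint.mono_left htp).eq_bot
  rw [h5, finrank_bot] at h4
  refine ⟨⟨t ⊔ c, by omega⟩, ?_, ?_⟩
  · rw [finrank_pos_iff_exists_ne_zero]
    exact ⟨⟨e, Submodule.mem_sup_left het, e.2⟩, fun h => he' (congrArg Subtype.val h)⟩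
  · simp only
    rw [sup_inf_assoc_of_le c htp, inf_comm, hc.inf_eq_bot, sup_bot_eq, ht]
    omega

/-- A polarity fixing `x` and `y` relates the coefficients of `x ⊓ y` and of `x ⊔ y`. -/
theorem HasClassValues.inf_coeff_eq (hU : finrank K U = 2 * D) {x y : GrassmannVertex K U D}
    (h0 : 0 < finrank K ↥(x.1 ⊓ y.1)) (h1 : finrank K ↥(x.1 ⊓ y.1) < D)
    {F : ℕ → ℕ → ℝ} {m a b s o : ℝ}
    (H : HasClassValues x.1 y.1 (vectorSum (biradial F x y)) m a b s o) :
    m - a - b + s = (Nat.card K : ℝ) ^ (D - finrank K ↥(x.1 ⊓ y.1)) * (s - o) := by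
  obtain ⟨σ, hinj, hsup, hinf, hdim, hσx, hσy⟩ := exists_polarity hU x.2 y.2
  have hv (z : GrassmannVertex K U D) : finrank K (σ z.1) = D := by
    have := hdim z.1
    have := z.2
    omega
  have hd (s t : Submodule K U) (hs : finrank K s = D) (ht : finrank K t = D) :
      finrank K ↥(σ s ⊓ σ t) = finrank K ↥(s ⊓ t) := by
    rw [← hsup]
    have := hdim (s ⊔ t)
    have := finrank_sup_add_inf s t
    omega
  have hx := x.2
  have hy := y.2
  have hbij : Function.Bijective fun z : GrassmannVertex K U D =>
      (⟨σ z.1, hv z⟩ : GrassmannVertex K U D) :=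
    Finite.injective_iff_bijective.1 fun z z' h => Subtype.ext (hinj (congrArg Subtype.val h))
  -- The polarity permutes the vertices and preserves the dimensions of their intersections with
  -- each other and with `x`, `y`, so it preserves the transform.
  have hK (w : GrassmannVertex K U D) :
      kernelSum (biradial F x y) (σ w.1) = kernelSum (biradial F x y) w.1 := by
    symm
    refine Fintype.sum_bijective _ hbij _ _ fun z => ?_
    have e1 : finrank K ↥(x.1 ⊓ σ z.1) = finrank K ↥(x.1 ⊓ z.1) := by
      conv_lhs => rw [← hσx]
      exact hd _ _ x.2 z.2
    have e2 : finrank K ↥(y.1 ⊓ σ z.1) = finrank K ↥(y.1 ⊓ z.1) := by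
      conv_lhs => rw [← hσy]
      exact hd _ _ y.2 z.2
    simp only [biradial]
    rw [hd _ _ w.2 z.2, e1, e2]
  obtain ⟨w, hw0, hw1⟩ := exists_vertex_inf_sup hU x y h0 h1
  have hww := w.2
  have e3 : finrank K ↥(σ w.1 ⊓ x.1) = finrank K ↥(w.1 ⊓ x.1) := by
    conv_lhs => rw [← hσx]
    exact hd _ _ w.2 x.2
  have e4 : finrank K ↥(σ w.1 ⊓ y.1) = finrank K ↥(w.1 ⊓ y.1) := by
    conv_lhs => rw [← hσy]
    exact hd _ _ w.2 y.2
  have h3 := finrank_sup_add_inf x.1 y.1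
  have e5 : finrank K ↥(σ w.1 ⊓ (x.1 ⊓ y.1)) = 0 := by
    have : x.1 ⊓ y.1 = σ (x.1 ⊔ y.1) := by rw [hsup, hσx, hσy]
    rw [this, ← hsup]
    have := hdim (w.1 ⊔ (x.1 ⊔ y.1))
    have := finrank_sup_add_inf w.1 (x.1 ⊔ y.1)
    omega
  have e6 : finrank K ↥(σ w.1 ⊓ (x.1 ⊔ y.1)) =
      finrank K ↥(w.1 ⊓ (x.1 ⊓ y.1)) + (D - finrank K ↥(x.1 ⊓ y.1)) := by
    have : x.1 ⊔ y.1 = σ (x.1 ⊓ y.1) := by rw [hinf, hσx, hσy]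
    rw [this, ← hsup]
    have := hdim (w.1 ⊔ (x.1 ⊓ y.1))
    have := finrank_sup_add_inf w.1 (x.1 ⊓ y.1)
    omega
  have e7 : finrank K ↥(w.1 ⊓ (x.1 ⊔ y.1)) = D - finrank K ↥(x.1 ⊓ y.1) := by omega
  have key := hK w
  rw [H.kernelSum_eq, H.kernelSum_eq, e3, e4, e5, e6, e7, hv w, w.2, pow_add] at key
  have hq := one_lt_card_real K
  have hA := one_lt_pow₀ hq hw0.ne'
  set Q := (Nat.card K : ℝ) ^ (D - finrank K ↥(x.1 ⊓ y.1))
  set A := (Nat.card K : ℝ) ^ finrank K ↥(w.1 ⊓ (x.1 ⊓ y.1))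
  -- In the expansions at `w` and at `σ w` the terms of `x` and `y` agree. The exponents for `x ⊓ y`
  -- are those of `A` and `1`, those for `x ⊔ y` of `Q` and `A * Q`.
  have : (m - a - b + s - Q * (s - o)) * (A - 1) = 0 := by linear_combination -key
  rcases mul_eq_zero.1 this with h | h
  · linarith
  · linarith

end Polarity

/-! ### Counting neighbours of `x` by their distance to `y` -/

section Counting

variable {K U : Type*} [Field K] [Finite K] [AddCommGroup U] [Module K U] [FiniteDimensional K U]
  {D : ℕ}

open Classical in
theorem card_filter_mem_notMem [Fintype U] (s t : Submodule K U) :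
    ((Finset.univ.filter fun u => u ∈ s ∧ u ∉ t).card : ℝ) =
      (Nat.card K : ℝ) ^ finrank K s - (Nat.card K : ℝ) ^ finrank K ↥(s ⊓ t) := by
  rw [← sum_ite_mem, ← sum_ite_mem, ← Finset.sum_sub_distrib, Finset.card_filter, Nat.cast_sum]
  refine Finset.sum_congr rfl fun u _ => ?_
  by_cases hs : u ∈ s <;> by_cases ht : u ∈ t <;> simp [hs, ht]

open Classical in
/-- Neighbours of `x` are counted through pairs of a functional and a vector. -/
theorem card_mul_card_eq_card_neighbors [Fintype U] [Fintype (Dual K U)]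
    (x : GrassmannVertex K U D)
    (Φ : Finset (Dual K U)) (W : Finset U) (S : Finset (GrassmannVertex K U D)) (m n : ℝ)
    (hΦ : ∀ f ∈ Φ, f ∉ x.1.dualAnnihilator) (hW : ∀ v ∈ W, v ∉ x.1)
    (hS : ∀ f ∈ Φ, ∀ v ∈ W, ∀ z : GrassmannVertex K U D,
      x.1 ⊓ z.1 = x.1 ⊓ LinearMap.ker f → v ∈ z.1 → z ∈ S)
    (hm : ∀ z ∈ S, ((Φ.filter fun f => x.1 ⊓ z.1 = x.1 ⊓ LinearMap.ker f).card : ℝ) = m)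
    (hn : ∀ z ∈ S, ((W.filter (· ∈ z.1)).card : ℝ) = n) :
    (S.card : ℝ) * (m * n) = Φ.card * W.card := by
  have key := Finset.sum_card_bipartiteAbove_eq_sum_card_bipartiteBelow (s := Φ ×ˢ W) (t := S)
    (fun (p : Dual K U × U) (z : GrassmannVertex K U D) =>
      x.1 ⊓ z.1 = x.1 ⊓ LinearMap.ker p.1 ∧ p.2 ∈ z.1)
  rw [Finset.sum_congr rfl (g := fun _ => 1), Finset.sum_const, Finset.card_product, smul_eq_mul,
    mul_one] at key
  · rw [← Nat.cast_mul, key, Nat.cast_sum, Finset.sum_congr rfl (g := fun _ => m * n),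
      Finset.sum_const, nsmul_eq_mul]
    intro z hz
    rw [← hm z hz, ← hn z hz, ← Nat.cast_mul, ← Finset.card_product, ← Finset.filter_product]
    rfl
  · rintro ⟨f, v⟩ hp
    obtain ⟨hf, hv⟩ := Finset.mem_product.1 hp
    obtain ⟨z, hz, huniq⟩ := existsUnique_neighbor x (hΦ f hf) (hW v hv)
    rw [Finset.card_eq_one]
    refine ⟨z, Finset.eq_singleton_iff_unique_mem.2 ⟨?_, fun z' hz' => ?_⟩⟩
    · exact Finset.mem_filter.2 ⟨hS f hf v hv z hz.1 hz.2, hz⟩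
    · exact huniq z' (Finset.mem_filter.1 hz').2

open Classical in
-- These functionals vanish on `x ⊓ z` but not on `x`; the two annihilators have dimensions `D + 1`
-- and `D`.
theorem card_functionals_cutting [Fintype (Dual K U)] (hU : finrank K U = 2 * D)
    {x z : GrassmannVertex K U D} (hxz : finrank K ↥(x.1 ⊓ z.1) + 1 = D) :
    ((Finset.univ.filter fun f : Dual K U =>
      f ∉ x.1.dualAnnihilator ∧ x.1 ⊓ z.1 = x.1 ⊓ LinearMap.ker f).card : ℝ) =
      (Nat.card K : ℝ) ^ (D + 1) - (Nat.card K : ℝ) ^ D := by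
  have hx := x.2
  have h1 := Subspace.finrank_add_finrank_dualAnnihilator_eq (x.1 ⊓ z.1)
  have h2 := Subspace.finrank_add_finrank_dualAnnihilator_eq x.1
  have h3 : (x.1 ⊓ z.1).dualAnnihilator ⊓ x.1.dualAnnihilator = x.1.dualAnnihilator :=
    inf_eq_right.2 (Submodule.dualAnnihilator_anti inf_le_left)
  have h4 := card_filter_mem_notMem (x.1 ⊓ z.1).dualAnnihilator x.1.dualAnnihilator
  rw [h3, (by omega : finrank K (x.1 ⊓ z.1).dualAnnihilator = D + 1),
    (by omega : finrank K x.1.dualAnnihilator = D)] at h4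
  rw [← h4]
  congr 2
  ext f
  simp only [Finset.mem_filter, Finset.mem_univ, true_and]
  constructor
  · rintro ⟨hf, h⟩
    refine ⟨?_, hf⟩
    rw [h, Submodule.mem_dualAnnihilator]
    exact fun w hw => hw.2
  · rintro ⟨hf, hfx⟩
    refine ⟨hfx, Submodule.eq_of_le_of_finrank_le (le_inf inf_le_left fun w hw => ?_) ?_⟩
    · exact (Submodule.mem_dualAnnihilator f).1 hf w hw
    · have := finrank_inf_ker_add_one hfx
      omega

/-- Inside `z`, the hyperplane `x ⊓ z` meets `y ⊓ z` in dimension at least `dim (x ⊓ y)`, so the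
triple intersection is all of `x ⊓ y`. -/
theorem inf_le_of_finrank_inf_eq {x y z : GrassmannVertex K U D}
    (hxz : finrank K ↥(x.1 ⊓ z.1) + 1 = D)
    (hyz : finrank K ↥(y.1 ⊓ z.1) = finrank K ↥(x.1 ⊓ y.1) + 1) : x.1 ⊓ y.1 ≤ z.1 := by
  have h1 := finrank_sup_add_inf (x.1 ⊓ z.1) (y.1 ⊓ z.1)
  have h2 := finrank_le_of_le (sup_le inf_le_right inf_le_right : x.1 ⊓ z.1 ⊔ y.1 ⊓ z.1 ≤ z.1)
  have hz := z.2
  have h3 : (x.1 ⊓ z.1) ⊓ (y.1 ⊓ z.1) = x.1 ⊓ y.1 :=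
    Submodule.eq_of_le_of_finrank_le (le_inf (inf_le_left.trans inf_le_left)
      (inf_le_right.trans inf_le_left)) (by omega)
  rw [← h3]
  exact inf_le_left.trans inf_le_right

/-- Otherwise `z ≤ x ⊔ y`, hence `y ⊔ z ≤ x ⊔ y`, although `y ⊔ z` has the larger dimension. -/
theorem inf_sup_eq_of_finrank_inf_eq {x y z : GrassmannVertex K U D}
    (hxz : finrank K ↥(x.1 ⊓ z.1) + 1 = D)
    (hyz : finrank K ↥(y.1 ⊓ z.1) + 1 = finrank K ↥(x.1 ⊓ y.1)) :
    z.1 ⊓ (x.1 ⊔ y.1) = x.1 ⊓ z.1 := by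
  symm
  refine Submodule.eq_of_le_of_finrank_le (le_inf inf_le_right (inf_le_left.trans le_sup_left)) ?_
  by_contra! h
  have hx := x.2
  have hy := y.2
  have hz := z.2
  have h1 : z.1 ⊓ (x.1 ⊔ y.1) = z.1 := Submodule.eq_of_le_of_finrank_le inf_le_left (by omega)
  have h2 := finrank_le_of_le (sup_le le_sup_right (inf_eq_left.1 h1) : y.1 ⊔ z.1 ≤ x.1 ⊔ y.1)
  have h3 := finrank_sup_add_inf x.1 y.1
  have h4 := finrank_sup_add_inf y.1 z.1
  omega

open Classical in
/-- The number of neighbours of `x` closer to `y`. -/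
theorem card_closer (hU : finrank K U = 2 * D) (x y : GrassmannVertex K U D) :
    ((Finset.univ.filter fun z : GrassmannVertex K U D => finrank K ↥(x.1 ⊓ z.1) + 1 = D ∧
      finrank K ↥(y.1 ⊓ z.1) = finrank K ↥(x.1 ⊓ y.1) + 1).card : ℝ) *
      (((Nat.card K : ℝ) ^ (D + 1) - (Nat.card K : ℝ) ^ D) *
        ((Nat.card K : ℝ) ^ (finrank K ↥(x.1 ⊓ y.1) + 1) -
          (Nat.card K : ℝ) ^ finrank K ↥(x.1 ⊓ y.1))) =
      ((Nat.card K : ℝ) ^ (2 * D - finrank K ↥(x.1 ⊓ y.1)) - (Nat.card K : ℝ) ^ D) *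
        ((Nat.card K : ℝ) ^ D - (Nat.card K : ℝ) ^ finrank K ↥(x.1 ⊓ y.1)) := by
  have : Finite U := Module.finite_of_finite K
  have : Finite (Dual K U) := Module.finite_of_finite K
  let _ := Fintype.ofFinite U
  let _ := Fintype.ofFinite (Dual K U)
  have hx := x.2
  have hy := y.2
  have ha := Subspace.finrank_add_finrank_dualAnnihilator_eq (x.1 ⊓ y.1)
  have hb := Subspace.finrank_add_finrank_dualAnnihilator_eq x.1
  have hΦ := card_filter_mem_notMem (x.1 ⊓ y.1).dualAnnihilator x.1.dualAnnihilator
  rw [inf_eq_right.2 (Submodule.dualAnnihilator_anti inf_le_left),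
    (by omega : finrank K (x.1 ⊓ y.1).dualAnnihilator = 2 * D - finrank K ↥(x.1 ⊓ y.1)),
    (by omega : finrank K x.1.dualAnnihilator = D)] at hΦ
  have hW := card_filter_mem_notMem y.1 x.1
  rw [hy, inf_comm y.1] at hW
  rw [← hΦ, ← hW]
  -- Closer neighbours arise from functionals vanishing on `x ⊓ y` but not on `x`, and from vectors
  -- of `y` outside `x`.
  refine card_mul_card_eq_card_neighbors x _ _ _ _ _ (fun f hf => (Finset.mem_filter.1 hf).2.2)
    (fun v hv => (Finset.mem_filter.1 hv).2.2) ?_ ?_ ?_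
  · intro f hf v hv z hz hvz
    obtain ⟨hf, hfx⟩ := (Finset.mem_filter.1 hf).2
    obtain ⟨hvy, hvx⟩ := (Finset.mem_filter.1 hv).2
    have h1 := finrank_inf_ker_add_one hfx
    have hxz : finrank K ↥(x.1 ⊓ z.1) + 1 = D := by rw [hz, h1, hx]
    refine Finset.mem_filter.2 ⟨Finset.mem_univ _, hxz, ?_⟩
    have h2 : x.1 ⊓ y.1 < y.1 ⊓ z.1 := by
      refine lt_of_le_of_ne (le_inf inf_le_right fun w hw => ?_) fun h => hvx ?_
      · have : w ∈ x.1 ⊓ z.1 := hz ▸ ⟨hw.1, (Submodule.mem_dualAnnihilator f).1 hf w hw⟩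
        exact this.2
      · have : v ∈ x.1 ⊓ y.1 := h ▸ ⟨hvy, hvz⟩
        exact this.1
    have h3 := Submodule.finrank_lt_finrank_of_lt h2
    have h4 := finrank_inf_le_of_adj y.1 (grassmannGraph_adj.2 hxz).symm
    rw [inf_comm z.1] at h4
    omega
  · intro z hz
    obtain ⟨hxz, hyz⟩ := (Finset.mem_filter.1 hz).2
    rw [← card_functionals_cutting hU hxz, Finset.filter_filter]
    congr 2
    ext f
    simp only [Finset.mem_filter, Finset.mem_univ, true_and]
    refine ⟨fun h => ⟨h.1.2, h.2⟩, fun h => ⟨⟨?_, h.1⟩, h.2⟩⟩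
    rw [Submodule.mem_dualAnnihilator]
    intro w hw
    have : w ∈ x.1 ⊓ LinearMap.ker f := h.2 ▸ ⟨hw.1, inf_le_of_finrank_inf_eq hxz hyz hw⟩
    exact this.2
  · intro z hz
    obtain ⟨hxz, hyz⟩ := (Finset.mem_filter.1 hz).2
    have h1 := card_filter_mem_notMem (y.1 ⊓ z.1) x.1
    have h2 : (y.1 ⊓ z.1) ⊓ x.1 = x.1 ⊓ y.1 :=
      le_antisymm (fun v hv => ⟨hv.2, hv.1.1⟩)
        fun v hv => ⟨⟨hv.2, inf_le_of_finrank_inf_eq hxz hyz hv⟩, hv.1⟩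
    rw [hyz, h2] at h1
    rw [← h1, Finset.filter_filter]
    congr 2
    ext v
    simp only [Finset.mem_filter, Finset.mem_univ, true_and, Submodule.mem_inf]
    tauto

open Classical in
/-- The number of neighbours of `x` farther from `y`. -/
theorem card_farther (hU : finrank K U = 2 * D) (x y : GrassmannVertex K U D) :
    ((Finset.univ.filter fun z : GrassmannVertex K U D => finrank K ↥(x.1 ⊓ z.1) + 1 = D ∧
      finrank K ↥(y.1 ⊓ z.1) + 1 = finrank K ↥(x.1 ⊓ y.1)).card : ℝ) *
      (((Nat.card K : ℝ) ^ (D + 1) - (Nat.card K : ℝ) ^ D) *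
        ((Nat.card K : ℝ) ^ D - (Nat.card K : ℝ) ^ (D - 1))) =
      ((Nat.card K : ℝ) ^ (2 * D) - (Nat.card K : ℝ) ^ (2 * D - finrank K ↥(x.1 ⊓ y.1))) *
        ((Nat.card K : ℝ) ^ (2 * D) - (Nat.card K : ℝ) ^ (2 * D - finrank K ↥(x.1 ⊓ y.1))) := by
  have : Finite U := Module.finite_of_finite K
  have : Finite (Dual K U) := Module.finite_of_finite K
  let _ := Fintype.ofFinite U
  let _ := Fintype.ofFinite (Dual K U)
  have hx := x.2
  have hy := y.2
  have ha := Subspace.finrank_add_finrank_dualAnnihilator_eq (x.1 ⊓ y.1)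
  have hs := finrank_sup_add_inf x.1 y.1
  have hΦ := card_filter_mem_notMem ⊤ (x.1 ⊓ y.1).dualAnnihilator
  rw [top_inf_eq,
    (by omega : finrank K (x.1 ⊓ y.1).dualAnnihilator = 2 * D - finrank K ↥(x.1 ⊓ y.1)),
    finrank_top, Subspace.dual_finrank_eq, hU] at hΦ
  have hW := card_filter_mem_notMem ⊤ (x.1 ⊔ y.1)
  rw [top_inf_eq, finrank_top, hU,
    (by omega : finrank K ↥(x.1 ⊔ y.1) = 2 * D - finrank K ↥(x.1 ⊓ y.1))] at hW
  nth_rewrite 1 [← hΦ]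
  rw [← hW]
  -- Farther neighbours arise from functionals not vanishing on `x ⊓ y` and vectors outside `x ⊔ y`.
  refine card_mul_card_eq_card_neighbors x _ _ _ _ _
    (fun f hf h => (Finset.mem_filter.1 hf).2.2 (Submodule.dualAnnihilator_anti inf_le_left h))
    (fun v hv h => (Finset.mem_filter.1 hv).2.2 (Submodule.mem_sup_left h)) ?_ ?_ ?_
  · intro f hf v hv z hz hvz
    have hf := (Finset.mem_filter.1 hf).2.2
    have hv := (Finset.mem_filter.1 hv).2.2
    have hfx : f ∉ x.1.dualAnnihilator := fun h => hf (Submodule.dualAnnihilator_anti inf_le_left h)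
    have h1 := finrank_inf_ker_add_one hfx
    have h2 := finrank_inf_ker_add_one hf
    have hxz : finrank K ↥(x.1 ⊓ z.1) + 1 = D := by rw [hz, h1, hx]
    refine Finset.mem_filter.2 ⟨Finset.mem_univ _, hxz, ?_⟩
    have h3 : z.1 ⊓ (x.1 ⊔ y.1) < z.1 :=
      lt_of_le_of_ne inf_le_left fun h => hv (h.symm ▸ hvz : v ∈ z.1 ⊓ (x.1 ⊔ y.1)).2
    have h4 := Submodule.finrank_lt_finrank_of_lt h3
    have h5 : x.1 ⊓ z.1 = z.1 ⊓ (x.1 ⊔ y.1) := by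
      have := z.2
      exact Submodule.eq_of_le_of_finrank_le
        (le_inf inf_le_right (inf_le_left.trans le_sup_left)) (by omega)
    have h6 : y.1 ⊓ z.1 = (x.1 ⊓ y.1) ⊓ LinearMap.ker f := by
      refine le_antisymm (fun w hw => ?_) fun w hw => ?_
      · have h7 : w ∈ x.1 ⊓ z.1 := h5 ▸ ⟨hw.2, Submodule.mem_sup_right hw.1⟩
        have h8 : w ∈ x.1 ⊓ LinearMap.ker f := hz ▸ h7
        exact ⟨⟨h7.1, hw.1⟩, h8.2⟩
      · have h8 : w ∈ x.1 ⊓ z.1 := hz ▸ ⟨hw.1.1, hw.2⟩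
        exact ⟨hw.1.2, h8.2⟩
    rw [h6, h2]
  · intro z hz
    obtain ⟨hxz, hyz⟩ := (Finset.mem_filter.1 hz).2
    rw [← card_functionals_cutting hU hxz, Finset.filter_filter]
    congr 2
    ext f
    simp only [Finset.mem_filter, Finset.mem_univ, true_and, Submodule.mem_top]
    refine ⟨fun h => ⟨fun h' => h.1 (Submodule.dualAnnihilator_anti inf_le_left h'), h.2⟩,
      fun h => ⟨fun hf => ?_, h.2⟩⟩
    have h1 : x.1 ⊓ y.1 ≤ y.1 ⊓ z.1 := by
      refine le_inf inf_le_right fun w hw => ?_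
      have h8 : w ∈ x.1 ⊓ z.1 := h.2 ▸ ⟨hw.1, (Submodule.mem_dualAnnihilator f).1 hf w hw⟩
      exact h8.2
    have := finrank_le_of_le h1
    omega
  · intro z hz
    obtain ⟨hxz, hyz⟩ := (Finset.mem_filter.1 hz).2
    have h1 := card_filter_mem_notMem z.1 (x.1 ⊔ y.1)
    rw [z.2, inf_sup_eq_of_finrank_inf_eq hxz hyz,
      (by omega : finrank K ↥(x.1 ⊓ z.1) = D - 1)] at h1
    rw [← h1, Finset.filter_filter]
    congr 2
    ext v
    simp only [Finset.mem_filter, Finset.mem_univ, true_and, Submodule.mem_top]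
    tauto

end Counting

/-! ### Solving for the class values -/

section ClassValueAlgebra

variable {Q R I J m a b s f N T : ℝ}

/-- For `dim (x ⊓ y) = r` and `∂(x, y) = i + 1`, read `Q = q`, `R = q ^ r`, `I = q ^ (i + 1)`, `J =
q ^ i`; `N` counts closer neighbours and `T` is the weighted count of farther ones. The equations
are the transform at `x ⊓ y`, `x`, `y`, `x ⊔ y`. Differences eliminate `m` and `f`, and the
alternating sum isolates `s`. -/
theorem classValues_of_sums (hQ : 1 < Q) (hR : 0 < R) (hI : 1 < I) (hJ : I = Q * J)
    (hN : N * (Q - 1) ^ 2 = (I - 1) ^ 2)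
    (h₁ : m * R + f = N * R + T * (R / Q))
    (h₂ : a * (R * I) + (m - a) * R + f = (N + T) * (R * J))
    (h₃ : b * (R * I) + (m - b) * R + f = N * (Q * R) + T * (R / Q))
    (h₄ : (a - s) * (R * I) + (b - s) * (R * I) + (m - a - b + s) * R + s * (R * I * I) + f =
      N * (R * I) + T * (R * J)) :
    a * (Q - 1) ^ 2 = (I - 1) * (J - 1) + T / Q * (Q - 1) ^ 2 ∧ b * (Q - 1) = I - 1 ∧
      s * (Q - 1) = J - 1 := by
  have hQ0 : Q ≠ 0 := by positivity
  have hI1 : R * (I - 1) ≠ 0 := mul_ne_zero hR.ne' (by linarith)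
  have hI2 : R * (I - 1) ^ 2 ≠ 0 := mul_ne_zero hR.ne' (pow_ne_zero _ (by linarith))
  have hT : T = Q * (T / Q) := by field_simp
  have hTR : T * (R / Q) = R * (T / Q) := by ring
  rw [hTR] at h₁ h₃
  set t := T / Q
  have hQ1 : Q - 1 ≠ 0 := by linarith
  refine ⟨mul_left_cancel₀ hI1 ?_, mul_left_cancel₀ (mul_ne_zero hI1 hQ1) ?_,
    mul_left_cancel₀ (mul_ne_zero hI2 hQ1) ?_⟩
  · rw [hT] at h₂
    subst hJ
    linear_combination (Q - 1) ^ 2 * (h₂ - h₁) + R * (J - 1) * hN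
  · linear_combination (Q - 1) ^ 2 * (h₃ - h₁) + R * (Q - 1) * hN
  · rw [hT] at h₂ h₄
    subst hJ
    linear_combination (Q - 1) ^ 2 * (h₄ - h₂ - h₃ + h₁) + R * (Q - 1) * (J - 1) * hN

end ClassValueAlgebra

/-! ### Class values of weighted neighbour sums -/

section NeighborSums

variable {K U : Type*} [Field K] [Finite K] [AddCommGroup U] [Module K U] [FiniteDimensional K U]
  {D : ℕ}

open Classical in
/-- The weight of a neighbour `z` of `x`, where `k` and `l` are the dimensions of `x ⊓ z` and of
`y ⊓ z`, and `r` is the dimension of `x ⊓ y`. -/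
noncomputable def neighborWeight (D r : ℕ) (ρ : ℝ) (k l : ℕ) : ℝ :=
  (if k + 1 = D ∧ l = r + 1 then 1 else 0) + ρ * (if k + 1 = D ∧ l + 1 = r then 1 else 0)

open Classical in
theorem kernelSum_neighborWeight (ρ : ℝ) (x y : GrassmannVertex K U D) (w : Submodule K U)
    (c d : ℝ)
    (hc : ∀ z : GrassmannVertex K U D, finrank K ↥(x.1 ⊓ z.1) + 1 = D →
      finrank K ↥(y.1 ⊓ z.1) = finrank K ↥(x.1 ⊓ y.1) + 1 →
      (Nat.card K : ℝ) ^ finrank K ↥(w ⊓ z.1) = c)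
    (hd : ∀ z : GrassmannVertex K U D, finrank K ↥(x.1 ⊓ z.1) + 1 = D →
      finrank K ↥(y.1 ⊓ z.1) + 1 = finrank K ↥(x.1 ⊓ y.1) →
      (Nat.card K : ℝ) ^ finrank K ↥(w ⊓ z.1) = d) :
    kernelSum (biradial (neighborWeight D (finrank K ↥(x.1 ⊓ y.1)) ρ) x y) w =
      ((Finset.univ.filter fun z : GrassmannVertex K U D => finrank K ↥(x.1 ⊓ z.1) + 1 = D ∧
        finrank K ↥(y.1 ⊓ z.1) = finrank K ↥(x.1 ⊓ y.1) + 1).card : ℝ) * c +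
      ρ * ((Finset.univ.filter fun z : GrassmannVertex K U D => finrank K ↥(x.1 ⊓ z.1) + 1 = D ∧
      finrank K ↥(y.1 ⊓ z.1) + 1 = finrank K ↥(x.1 ⊓ y.1)).card : ℝ) * d := by
  rw [Finset.card_filter, Finset.card_filter, Nat.cast_sum, Nat.cast_sum, Finset.sum_mul,
    Finset.mul_sum, Finset.sum_mul, ← Finset.sum_add_distrib]
  refine Finset.sum_congr rfl fun z _ => ?_
  simp only [biradial, neighborWeight]
  by_cases h1 : finrank K ↥(x.1 ⊓ z.1) + 1 = D ∧
      finrank K ↥(y.1 ⊓ z.1) = finrank K ↥(x.1 ⊓ y.1) + 1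
  · have h2 : ¬ (finrank K ↥(x.1 ⊓ z.1) + 1 = D ∧
      finrank K ↥(y.1 ⊓ z.1) + 1 = finrank K ↥(x.1 ⊓ y.1)) := by omega
    rw [if_pos h1, if_neg h2, if_pos h1, if_neg h2, hc z h1.1 h1.2]
    simp
  · by_cases h2 : finrank K ↥(x.1 ⊓ z.1) + 1 = D ∧
      finrank K ↥(y.1 ⊓ z.1) + 1 = finrank K ↥(x.1 ⊓ y.1)
    · rw [if_neg h1, if_pos h2, if_neg h1, if_pos h2, hd z h2.1 h2.2]
      simp
      ring
    · rw [if_neg h1, if_neg h2, if_neg h1, if_neg h2]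
      simp

theorem HasClassValues.kernelSum_inf {h : GrassmannVertex K U D → ℝ} {x y : Submodule K U}
    {m a b s o : ℝ} (H : HasClassValues x y (vectorSum h) m a b s o) :
    kernelSum h (x ⊓ y) = m * (Nat.card K : ℝ) ^ finrank K ↥(x ⊓ y) + (vectorSum h 0 - m) := by
  rw [H.kernelSum_eq, (inf_eq_left.2 inf_le_left : x ⊓ y ⊓ x = x ⊓ y),
    (inf_eq_left.2 inf_le_right : x ⊓ y ⊓ y = x ⊓ y), inf_idem,
    (inf_eq_left.2 (inf_le_left.trans le_sup_left) : x ⊓ y ⊓ (x ⊔ y) = x ⊓ y)]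
  ring

theorem HasClassValues.kernelSum_left {h : GrassmannVertex K U D → ℝ} {x y : Submodule K U}
    {m a b s o : ℝ} (H : HasClassValues x y (vectorSum h) m a b s o) :
    kernelSum h x = a * (Nat.card K : ℝ) ^ finrank K x
      + (m - a) * (Nat.card K : ℝ) ^ finrank K ↥(x ⊓ y) + (vectorSum h 0 - m) := by
  rw [H.kernelSum_eq, inf_idem, (inf_eq_right.2 inf_le_left : x ⊓ (x ⊓ y) = x ⊓ y),
    (inf_eq_left.2 le_sup_left : x ⊓ (x ⊔ y) = x)]
  ring

theorem HasClassValues.kernelSum_right {h : GrassmannVertex K U D → ℝ} {x y : Submodule K U}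
    {m a b s o : ℝ} (H : HasClassValues x y (vectorSum h) m a b s o) :
    kernelSum h y = b * (Nat.card K : ℝ) ^ finrank K y
      + (m - b) * (Nat.card K : ℝ) ^ finrank K ↥(x ⊓ y) + (vectorSum h 0 - m) := by
  rw [H.kernelSum_eq, inf_idem, (inf_eq_right.2 inf_le_right : y ⊓ (x ⊓ y) = x ⊓ y),
    (inf_eq_left.2 le_sup_right : y ⊓ (x ⊔ y) = y), inf_comm y x]
  ring

theorem HasClassValues.kernelSum_sup {h : GrassmannVertex K U D → ℝ} {x y : Submodule K U}
    {m a b s o : ℝ} (H : HasClassValues x y (vectorSum h) m a b s o) :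
    kernelSum h (x ⊔ y) = (a - s) * (Nat.card K : ℝ) ^ finrank K x
      + (b - s) * (Nat.card K : ℝ) ^ finrank K y
      + (m - a - b + s) * (Nat.card K : ℝ) ^ finrank K ↥(x ⊓ y)
      + s * (Nat.card K : ℝ) ^ finrank K ↥(x ⊔ y) + (vectorSum h 0 - m) := by
  rw [H.kernelSum_eq, (inf_eq_right.2 le_sup_left : (x ⊔ y) ⊓ x = x),
    (inf_eq_right.2 le_sup_right : (x ⊔ y) ⊓ y = y), inf_idem,
    (inf_eq_right.2 (inf_le_left.trans le_sup_left) : (x ⊔ y) ⊓ (x ⊓ y) = x ⊓ y)]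
  ring

theorem HasClassValues.kernelSum_top {h : GrassmannVertex K U D → ℝ} {x y : Submodule K U}
    {m a b s o : ℝ} (H : HasClassValues x y (vectorSum h) m a b s o) :
    kernelSum h ⊤ = (a - s) * (Nat.card K : ℝ) ^ finrank K x
      + (b - s) * (Nat.card K : ℝ) ^ finrank K y
      + (m - a - b + s) * (Nat.card K : ℝ) ^ finrank K ↥(x ⊓ y)
      + (s - o) * (Nat.card K : ℝ) ^ finrank K ↥(x ⊔ y)
      + o * (Nat.card K : ℝ) ^ finrank K U + (vectorSum h 0 - m) := by
  rw [H.kernelSum_eq, top_inf_eq, top_inf_eq, top_inf_eq, top_inf_eq, finrank_top]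

/-- The class values of the neighbour sums. -/
theorem HasClassValues.neighborWeight_values (hU : finrank K U = 2 * D)
    {x y : GrassmannVertex K U D} {r i : ℕ} (hr : finrank K ↥(x.1 ⊓ y.1) = r) (hi : r + i + 1 = D)
    {ρ T : ℝ} {m a b s o : ℝ}
    (H : HasClassValues x.1 y.1 (vectorSum (biradial (neighborWeight D r ρ) x y)) m a b s o)
    {Q R I J : ℝ} (hQ : Q = Nat.card K) (hR : R = Q ^ r) (hI : I = Q ^ (i + 1)) (hJ : J = Q ^ i)
    (hT : T * (Q - 1) ^ 2 = ρ * (Q * (R * I - I) ^ 2)) :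
    (a * (Q - 1) ^ 2 = (I - 1) * (J - 1) + T / Q * (Q - 1) ^ 2 ∧ b * (Q - 1) = I - 1 ∧
      s * (Q - 1) = J - 1) ∧ o * ((R * I) ^ 2 - R * I * I) = T * (R * I - R * J) := by
  classical
  have hs := finrank_sup_add_inf x.1 y.1
  rw [x.2, y.2, hr] at hs
  have hQ1 : 1 < Q := hQ ▸ one_lt_card_real K
  have hQ0 : Q ≠ 0 := by positivity
  have hRpos : 0 < R := hR ▸ by positivity
  have hI1 : 1 < I := hI ▸ one_lt_pow₀ hQ1 (by omega)
  have hJpos : 0 < J := hJ ▸ by positivity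
  have hIJ : I = Q * J := by rw [hI, hJ, pow_succ']
  have pD : Q ^ D = R * I := by rw [hR, hI, ← pow_add, ← hi, add_assoc]
  have pD1 : Q ^ (D - 1) = R * J := by
    rw [hR, hJ, ← pow_add]
    congr 1
    omega
  have p2D : Q ^ (2 * D) = (R * I) ^ 2 := by rw [← pD, ← pow_mul, mul_comm]
  have d1 : finrank K ↥(x.1 ⊔ y.1) = 2 * D - r := by omega
  have pS : Q ^ (2 * D - r) = R * I * I := by
    rw [← pD, hI, ← pow_add]
    congr 1
    omega
  have hNc := card_closer hU x y
  have hNb := card_farther hU x y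
  have e0 := H.kernelSum_inf
  have e1 := H.kernelSum_left
  have e2 := H.kernelSum_right
  have e3 := H.kernelSum_sup
  have e4 := H.kernelSum_top
  clear H
  rw [← hQ, x.2, y.2, hr, d1, hU, ← hR, pD, p2D, pS] at e4
  rw [← hQ, x.2, y.2, hr, d1, ← hR, pD, pS] at e3
  rw [← hQ, y.2, hr, ← hR, pD] at e2
  rw [← hQ, x.2, hr, ← hR, pD] at e1
  rw [← hQ, hr, ← hR] at e0
  have hr' := hr
  subst hr'
  -- On each of the five test subspaces, all closer neighbours contribute one power of `q` and all
  -- farther ones another. Writing `R / Q` for `q ^ (r - 1)` avoids truncated subtraction when `r =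
  -- 0`.
  rw [kernelSum_neighborWeight ρ x y (x.1 ⊓ y.1) R (R / Q)] at e0
  rw [kernelSum_neighborWeight ρ x y x.1 (R * J) (R * J)] at e1
  rw [kernelSum_neighborWeight ρ x y y.1 (Q * R) (R / Q)] at e2
  rw [kernelSum_neighborWeight ρ x y (x.1 ⊔ y.1) (R * I) (R * J)] at e3
  rw [kernelSum_neighborWeight ρ x y ⊤ (R * I) (R * I)] at e4
  · rw [← hQ, pow_succ', pow_succ', pD, pS, ← hR] at hNc
    rw [← hQ, pow_succ', pD, p2D, pS, pD1] at hNb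
    generalize ((Finset.univ.filter fun z : GrassmannVertex K U D =>
      finrank K ↥(x.1 ⊓ z.1) + 1 = D ∧
        finrank K ↥(y.1 ⊓ z.1) = finrank K ↥(x.1 ⊓ y.1) + 1).card : ℝ) = Nc at *
    generalize ((Finset.univ.filter fun z : GrassmannVertex K U D =>
      finrank K ↥(x.1 ⊓ z.1) + 1 = D ∧
        finrank K ↥(y.1 ⊓ z.1) + 1 = finrank K ↥(x.1 ⊓ y.1)).card : ℝ) = Nb at *
    generalize vectorSum (biradial (neighborWeight D (finrank K ↥(x.1 ⊓ y.1)) ρ) x y) 0 = f₀ at *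
    have hc : Nc * (Q - 1) ^ 2 = (I - 1) ^ 2 := by
      have h0 : R ^ 2 * I ≠ 0 := by positivity
      refine mul_left_cancel₀ h0 ?_
      linear_combination hNc
    have hb : Nb * (Q - 1) ^ 2 = Q * (R * I - I) ^ 2 := by
      have h0 : R ^ 2 * I * J ≠ 0 := by positivity
      refine mul_left_cancel₀ h0 ?_
      rw [hIJ] at hNb ⊢
      linear_combination hNb
    have hTb : T = ρ * Nb := by
      have h0 : (Q - 1) ^ 2 ≠ 0 := pow_ne_zero _ (by linarith)
      refine mul_right_cancel₀ h0 ?_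
      rw [hT, ← hb]
      ring
    rw [← hTb] at e0 e1 e2 e3 e4
    refine ⟨classValues_of_sums hQ1 hRpos hI1 hIJ hc (T := T) (f := f₀ - m) (m := m)
      ?_ ?_ ?_ ?_, ?_⟩
    · linear_combination -e0
    · linear_combination -e1
    · linear_combination -e2
    · linear_combination -e3
    -- Closer neighbours lie in `x ⊔ y`, so they cancel between the transforms at `⊤` and at `x ⊔
    -- y`, leaving only `o` and `T`.
    · linear_combination e3 - e4
  · intro z _ _
    rw [top_inf_eq, z.2, ← hQ, pD]
  · intro z _ _
    rw [top_inf_eq, z.2, ← hQ, pD]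
  · intro z hxz hyz
    have h1 : z.1 ≤ x.1 ⊔ y.1 := by
      have h2 := inf_le_of_finrank_inf_eq hxz hyz
      have h3 := finrank_sup_add_inf (x.1 ⊓ z.1) (y.1 ⊓ z.1)
      have h4 : x.1 ⊓ z.1 ⊓ (y.1 ⊓ z.1) = x.1 ⊓ y.1 :=
        le_antisymm (fun v hv => ⟨hv.1.1, hv.2.1⟩)
          fun v hv => ⟨⟨hv.1, h2 hv⟩, ⟨hv.2, h2 hv⟩⟩
      rw [h4] at h3
      have hz := z.2
      have h5 : x.1 ⊓ z.1 ⊔ y.1 ⊓ z.1 = z.1 :=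
        Submodule.eq_of_le_of_finrank_le (sup_le inf_le_right inf_le_right) (by omega)
      rw [← h5]
      exact sup_le_sup inf_le_left inf_le_left
    rw [inf_eq_right.2 h1, z.2, ← hQ, pD]
  · intro z hxz hyz
    rw [inf_comm, inf_sup_eq_of_finrank_inf_eq hxz hyz, ← hQ, ← pD1]
    congr 1
    omega
  · intro z _ hyz
    rw [hyz, ← hQ, pow_succ', hR]
  · intro z _ hyz
    rw [← hQ, eq_div_iff hQ0, ← pow_succ, hyz, hR]
  · intro z hxz _
    rw [← hQ, ← pD1]
    congr 1
    omega
  · intro z hxz _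
    rw [← hQ, ← pD1]
    congr 1
    omega
  · intro z hxz hyz
    have h2 := inf_le_of_finrank_inf_eq hxz hyz
    rw [inf_eq_left.2 h2, ← hQ, hR]
  · intro z hxz hyz
    have h1 := inf_sup_eq_of_finrank_inf_eq hxz hyz
    have h2 : x.1 ⊓ y.1 ⊓ z.1 = y.1 ⊓ z.1 := by
      refine le_antisymm (fun v hv => ⟨hv.1.2, hv.2⟩) fun v hv => ?_
      have h3 : v ∈ x.1 ⊓ z.1 := h1 ▸ ⟨hv.2, Submodule.mem_sup_right hv.1⟩
      exact ⟨⟨h3.1, hv.1⟩, hv.2⟩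
    rw [h2, ← hQ, eq_div_iff hQ0, ← pow_succ, hyz, hR]

end NeighborSums

/-! ### The Bose-Mesner algebra and the kernel as an eigenmatrix -/

section BoseMesner

variable {K U : Type*} [Field K] [Finite K] [AddCommGroup U] [Module K U] [FiniteDimensional K U]
  {D : ℕ}

theorem exists_eq_of_mem_boseMesner {X : Type*} [Fintype X] {G : SimpleGraph X} {M : Matrix X X ℝ}
    (hM : M ∈ boseMesner G) : ∃ b : ℕ → ℝ, ∀ x y, M x y = b (G.dist x y) := by
  induction hM using Submodule.span_induction with
  | mem M h =>
    obtain ⟨i, rfl⟩ := h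
    exact ⟨fun n => if n = i then 1 else 0, fun x y => rfl⟩
  | zero => exact ⟨0, fun x y => rfl⟩
  | add M N _ _ hM hN =>
    obtain ⟨b, hb⟩ := hM
    obtain ⟨c, hc⟩ := hN
    exact ⟨b + c, fun x y => by simp [hb, hc]⟩
  | smul t M _ hM =>
    obtain ⟨b, hb⟩ := hM
    exact ⟨t • b, fun x y => by simp [hb]⟩

theorem mem_boseMesner_of_eq {X : Type*} [Fintype X] {G : SimpleGraph X} {M : Matrix X X ℝ}
    (b : ℕ → ℝ) (hM : ∀ x y, M x y = b (G.dist x y)) : M ∈ boseMesner G := by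
  obtain ⟨N, hN⟩ : ∃ N, ∀ x y, G.dist x y < N := by
    obtain ⟨N, hN⟩ := Finite.exists_le fun p : X × X => G.dist p.1 p.2
    exact ⟨N + 1, fun x y => Nat.lt_succ_of_le (hN (x, y))⟩
  have : M = ∑ i ∈ Finset.range N, b i • distanceMatrix G i := by
    ext x y
    rw [Matrix.sum_apply]
    simp [distanceMatrix, hM, hN]
  rw [this]
  exact Submodule.sum_mem _ fun i _ => Submodule.smul_mem _ _ (Submodule.subset_span ⟨i, rfl⟩)

theorem mem_boseMesner_of_forall {X : Type*} [Fintype X] {G : SimpleGraph X} {M : Matrix X X ℝ}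
    (hM : ∀ x y x' y', G.dist x y = G.dist x' y' → M x y = M x' y') : M ∈ boseMesner G := by
  classical
  refine mem_boseMesner_of_eq
    (fun n => if h : ∃ p : X × X, G.dist p.1 p.2 = n then M h.choose.1 h.choose.2 else 0)
    fun x y => ?_
  have h : ∃ p : X × X, G.dist p.1 p.2 = G.dist x y := ⟨(x, y), rfl⟩
  rw [dif_pos h]
  exact hM _ _ _ _ h.choose_spec.symm

/-- An eigenmatrix in the Bose-Mesner algebra of a connected graph is determined by its diagonal. -/
theorem eq_zero_of_mem_boseMesner {X : Type*} [Fintype X] {G : SimpleGraph X} (hG : G.Connected)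
    {M : Matrix X X ℝ} (hM : M ∈ boseMesner G) {θ : ℝ} (hθ : distanceMatrix G 1 * M = θ • M)
    {x₀ : X} (h₀ : M x₀ x₀ = 0) : M = 0 := by
  obtain ⟨b, hb⟩ := exists_eq_of_mem_boseMesner hM
  have key (n : ℕ) : ∀ x y, G.dist x y ≤ n → M x y = 0 := by
    induction n with
    | zero =>
      intro x y h
      rw [hb, Nat.le_zero.1 h, ← G.dist_self (v := x₀), ← hb, h₀]
    | succ n ih =>
      intro x y h
      rcases h.lt_or_eq with h | h
      · exact ih x y (by omega)
      · obtain ⟨p, hp⟩ := hG.exists_walk_length_eq_dist x y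
        cases p with
        | nil => simp at h
        | @cons _ z _ hxz p =>
          rw [SimpleGraph.Walk.length_cons] at hp
          have h2 := SimpleGraph.dist_le p
          -- Here `z` is the next vertex on a geodesic from `x` to `y`. Neighbours of `z` within
          -- distance `n` of `y` contribute zero, and those at distance `n + 1`, among them `x`, all
          -- contribute `b (n + 1)`. So a positive multiple of `b (n + 1)` vanishes.
          have h3 := congrFun (congrFun hθ z) y
          rw [Matrix.smul_apply, ih z y (by omega), smul_zero, Matrix.mul_apply] at h3
          have h4 : ∀ w, distanceMatrix G 1 z w * M w y =
              distanceMatrix G 1 z w * (if G.dist w y = n + 1 then b (n + 1) else 0) := by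
            intro w
            by_cases hw : G.dist z w = 1
            · congr 1
              have h5 := hG.dist_triangle (u := w) (v := z) (w := y)
              rw [G.dist_comm (u := w) (v := z), hw] at h5
              split_ifs with h6
              · rw [hb, h6]
              · exact ih w y (by omega)
            · simp [distanceMatrix, hw]
          simp only [h4, mul_ite, mul_zero] at h3
          rw [hb, h]
          by_contra hne
          have h5 : ∑ w, (if G.dist w y = n + 1 then distanceMatrix G 1 z w * b (n + 1) else 0) =
              (∑ w, if G.dist w y = n + 1 then distanceMatrix G 1 z w else 0) * b (n + 1) := by
            rw [Finset.sum_mul]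
            exact Finset.sum_congr rfl fun w _ => by split_ifs <;> simp
          rw [h5] at h3
          have h6 := (mul_eq_zero.1 h3).resolve_right hne
          rw [Finset.sum_eq_zero_iff_of_nonneg] at h6
          · have h7 := h6 x (Finset.mem_univ _)
            rw [if_pos h] at h7
            simp [distanceMatrix, SimpleGraph.dist_eq_one_iff_adj.2 hxz.symm] at h7
          · intro w _
            simp only [distanceMatrix, Matrix.of_apply]
            split_ifs <;> norm_num
  ext x y
  exact key _ x y le_rfl

theorem exists_vertex (hU : finrank K U = 2 * D) (hD : 0 < D) :
    ∃ x y : GrassmannVertex K U D, x ≠ y := by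
  obtain ⟨x, -, -, hx⟩ := exists_between_finrank_eq (bot_le : (⊥ : Submodule K U) ≤ ⊤) (n := D)
    (by simp) (by rw [finrank_top]; omega)
  obtain ⟨y, hy⟩ := x.exists_isCompl
  have h := Submodule.finrank_add_eq_of_isCompl hy
  refine ⟨⟨x, hx⟩, ⟨y, by omega⟩, fun hxy => ?_⟩
  have : x = y := congrArg Subtype.val hxy
  subst this
  have h2 := hy.inf_eq_bot
  rw [inf_idem] at h2
  rw [h2, finrank_bot] at hx
  omega

theorem grassmannGraph_connected (hU : finrank K U = 2 * D) (hD : 0 < D) :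
    (grassmannGraph K U D).Connected := by
  obtain ⟨x, -, -⟩ := exists_vertex hU hD
  have : Nonempty (GrassmannVertex K U D) := ⟨x⟩
  refine ⟨fun x y => ?_⟩
  have := finrank_inf_le x y
  obtain ⟨p, -⟩ := exists_walk_length_eq (D - finrank K ↥(x.1 ⊓ y.1)) x y (by omega)
  exact p.reachable

/-- The matrix with entries `q ^ dim (x ⊓ y) - μ`. -/
noncomputable def kernelMatrix (K U : Type*) [Field K] [AddCommGroup U] [Module K U]
    (D : ℕ) (μ : ℝ) : Matrix (GrassmannVertex K U D) (GrassmannVertex K U D) ℝ :=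
  Matrix.of fun x y => (Nat.card K : ℝ) ^ finrank K ↥(x.1 ⊓ y.1) - μ

theorem kernelMatrix_apply (μ : ℝ) (x y : GrassmannVertex K U D) :
    kernelMatrix K U D μ x y = (Nat.card K : ℝ) ^ finrank K ↥(x.1 ⊓ y.1) - μ := rfl

theorem kernelMatrix_mulVec (μ : ℝ) (h : GrassmannVertex K U D → ℝ) (w : GrassmannVertex K U D) :
    (kernelMatrix K U D μ).mulVec h w = kernelSum h w.1 - μ * ∑ z, h z := by
  simp only [Matrix.mulVec, dotProduct, kernelMatrix_apply, kernelSum, sub_mul,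
    Finset.sum_sub_distrib, Finset.mul_sum]

open Classical in
/-- The adjacency matrix acts on the kernel with eigenvalue `θ₁`, up to a constant. -/
theorem exists_sum_neighbors_eq (hU : finrank K U = 2 * D) (hD : 0 < D) :
    ∃ k c : ℝ, grassmannEigenvalue (Nat.card K) D 1 < k ∧
      ∀ x : GrassmannVertex K U D,
        (∑ z : GrassmannVertex K U D, if finrank K ↥(x.1 ⊓ z.1) + 1 = D then (1 : ℝ) else 0) = k ∧
        ∀ w : GrassmannVertex K U D,
          kernelSum (fun z : GrassmannVertex K U D =>
            if finrank K ↥(x.1 ⊓ z.1) + 1 = D then (1 : ℝ) else 0) w.1 =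
          grassmannEigenvalue (Nat.card K) D 1 * (Nat.card K : ℝ) ^ finrank K ↥(w.1 ⊓ x.1) + c := by
  obtain ⟨Q, hQ⟩ : ∃ Q : ℝ, Q = Nat.card K := ⟨_, rfl⟩
  have hQ1 : 1 < Q := hQ ▸ one_lt_card_real K
  obtain ⟨Y, hY⟩ : ∃ Y : ℝ, Y = Q ^ (D - 1) := ⟨_, rfl⟩
  have hX : Q ^ D = Q * Y := by
    rw [hY, ← pow_succ']
    congr 1
    omega
  have hX2 : Q ^ (2 * D) = (Q * Y) ^ 2 := by rw [← hX, ← pow_mul, mul_comm]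
  have hY1 : 1 ≤ Y := hY ▸ one_le_pow₀ hQ1.le
  have hX1 : 0 < Q * Y - 1 := by nlinarith
  have hQ0 : 0 < Q - 1 := by linarith
  have hθ : grassmannEigenvalue (Nat.card K) D 1 = ((Q * Y - Q) / (Q - 1)) ^ 2 - 1 := by
    rw [grassmannEigenvalue, ← hQ, hX]
    simp
    rw [div_self hQ0.ne']
    ring
  rw [hθ]
  refine ⟨Q * ((Q * Y - 1) / (Q - 1)) ^ 2, (Q * Y - 1) / (Q - 1) * (Q * Y)
    + Q * ((Q * Y - 1) / (Q - 1)) ^ 2 - (Q * Y - 1) * (Q * Y - Q) / (Q - 1) ^ 2, ?_, fun x => ?_⟩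
  · have h1 : ((Q * Y - Q) / (Q - 1)) ^ 2 ≤ ((Q * Y - 1) / (Q - 1)) ^ 2 := by
      apply pow_le_pow_left₀
      · apply div_nonneg <;> nlinarith
      · gcongr
    have h2 : ((Q * Y - 1) / (Q - 1)) ^ 2 ≤ Q * ((Q * Y - 1) / (Q - 1)) ^ 2 :=
      le_mul_of_one_le_left (sq_nonneg _) hQ1.le
    linarith
  have hk : (∑ z : GrassmannVertex K U D, if finrank K ↥(x.1 ⊓ z.1) + 1 = D then (1 : ℝ) else 0) =
      Q * ((Q * Y - 1) / (Q - 1)) ^ 2 := by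
    -- With `y = x` every neighbour is farther, so this count is the valency.
    have h := card_farther hU x x
    rw [inf_idem, x.2] at h
    simp only [and_self] at h
    rw [← hQ, pow_succ', hX, hX2, (by omega : 2 * D - D = D), hX, ← hY] at h
    rw [Finset.sum_boole]
    have h0 : Q * Y * (Q - 1) * (Y * (Q - 1)) ≠ 0 := by positivity
    refine mul_right_cancel₀ h0 ?_
    have h2 : ((Q * Y - 1) / (Q - 1)) ^ 2 * (Q - 1) ^ 2 = (Q * Y - 1) ^ 2 := by
      field_simp
    linear_combination h - Q ^ 2 * Y ^ 2 * h2
  refine ⟨hk, fun w => ?_⟩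
  -- With `y = x` only `m` and `o` matter. The transforms at `x` and at `⊤` determine them, and the
  -- eigenvalue is `m - o`.
  obtain ⟨m, a, b, s, o, H⟩ := exists_hasClassValues (fun i _ => if i + 1 = D then 1 else 0) x x
  change HasClassValues x.1 x.1 (vectorSum fun z : GrassmannVertex K U D =>
    if finrank K ↥(x.1 ⊓ z.1) + 1 = D then (1 : ℝ) else 0) m a b s o at H
  have e1 := H.kernelSum_left
  have e2 := H.kernelSum_top
  rw [H.kernelSum_eq]
  have e3 : kernelSum (fun z : GrassmannVertex K U D =>
      if finrank K ↥(x.1 ⊓ z.1) + 1 = D then (1 : ℝ) else 0) x.1 =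
      Y * (Q * ((Q * Y - 1) / (Q - 1)) ^ 2) := by
    rw [← hk, kernelSum, Finset.mul_sum]
    refine Finset.sum_congr rfl fun z _ => ?_
    split_ifs with h
    · rw [hY, ← hQ, (by omega : finrank K ↥(x.1 ⊓ z.1) = D - 1)]
    · simp
  have e4 : kernelSum (fun z : GrassmannVertex K U D =>
      if finrank K ↥(x.1 ⊓ z.1) + 1 = D then (1 : ℝ) else 0) ⊤ =
      Q * Y * (Q * ((Q * Y - 1) / (Q - 1)) ^ 2) := by
    rw [← hk, kernelSum, Finset.mul_sum]
    refine Finset.sum_congr rfl fun z _ => ?_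
    rw [top_inf_eq, z.2, ← hQ, hX]
  have e5 : vectorSum (fun z : GrassmannVertex K U D =>
      if finrank K ↥(x.1 ⊓ z.1) + 1 = D then (1 : ℝ) else 0) (0 : U) =
      Q * ((Q * Y - 1) / (Q - 1)) ^ 2 := by
    rw [← hk, vectorSum]
    simp
  rw [e3, e5] at e1
  rw [e4, e5] at e2
  rw [inf_idem, x.2, ← hQ, hX] at e1
  rw [inf_idem, sup_idem, x.2, hU, ← hQ, hX, hX2] at e2
  rw [inf_idem, sup_idem, e5, w.2, ← hQ, hX]
  have hm : m = (Q * Y - 1) * (Q * Y - Q) / (Q - 1) ^ 2 := by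
    refine mul_right_cancel₀ hX1.ne' ?_
    have : Y * (Q * ((Q * Y - 1) / (Q - 1)) ^ 2) - Q * ((Q * Y - 1) / (Q - 1)) ^ 2 =
      (Q * Y - 1) * (Q * Y - Q) / (Q - 1) ^ 2 * (Q * Y - 1) := by
        field_simp
    linear_combination this - e1
  have ho : o = (Q * Y - 1) / (Q - 1) := by
    have h0 : Q * Y * (Q * Y - 1) ≠ 0 := by positivity
    refine mul_right_cancel₀ h0 ?_
    have : Q * Y * (Q * ((Q * Y - 1) / (Q - 1)) ^ 2) - Y * (Q * ((Q * Y - 1) / (Q - 1)) ^ 2)  =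
      (Q * Y - 1) / (Q - 1) * (Q * Y * (Q * Y - 1)) := by
        field_simp
    linear_combination this - e2 + e1
  have hmo : m - o = ((Q * Y - Q) / (Q - 1)) ^ 2 - 1 := by
    rw [hm, ho]
    field_simp
    ring
  rw [← hmo, ← hm, ← ho]
  ring

end BoseMesner

/-! ### Existence and uniqueness of the primitive idempotent -/

section PrimitiveIdempotent

variable {K U : Type*} [Field K] [Finite K] [AddCommGroup U] [Module K U] [FiniteDimensional K U]
  {D : ℕ}

open Classical in
theorem distanceMatrix_one_apply (x z : GrassmannVertex K U D) :
    distanceMatrix (grassmannGraph K U D) 1 x z =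
      if finrank K ↥(x.1 ⊓ z.1) + 1 = D then 1 else 0 := by
  simp only [distanceMatrix, Matrix.of_apply, grassmannGraph_dist_eq_one]

theorem kernelMatrix_comm (μ : ℝ) (x y : GrassmannVertex K U D) :
    kernelMatrix K U D μ x y = kernelMatrix K U D μ y x := by
  rw [kernelMatrix_apply, kernelMatrix_apply, inf_comm]

/-- A suitable shift of the kernel is an eigenmatrix with column sums zero. -/
theorem exists_kernelMatrix_eigen (hU : finrank K U = 2 * D) (hD : 0 < D) :
    ∃ μ : ℝ, distanceMatrix (grassmannGraph K U D) 1 * kernelMatrix K U D μ =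
        grassmannEigenvalue (Nat.card K) D 1 • kernelMatrix K U D μ ∧
      ∀ y, ∑ x, kernelMatrix K U D μ x y = 0 := by
  classical
  obtain ⟨k, c, hk, h⟩ := exists_sum_neighbors_eq hU hD
  set θ := grassmannEigenvalue (Nat.card K) D 1
  have hkθ : k - θ ≠ 0 := by linarith
  -- The shift solves `c - k * μ = -θ * μ`. Column sums then vanish because they are scaled both by
  -- `k` and by `θ < k`.
  have hA : distanceMatrix (grassmannGraph K U D) 1 * kernelMatrix K U D (c / (k - θ)) =
      θ • kernelMatrix K U D (c / (k - θ)) := by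
    ext x w
    rw [Matrix.mul_apply, Matrix.smul_apply, kernelMatrix_apply, smul_eq_mul]
    have h1 := (h x).2 w
    rw [kernelSum] at h1
    have h2 : ∑ z, distanceMatrix (grassmannGraph K U D) 1 x z *
        kernelMatrix K U D (c / (k - θ)) z w =
        (θ * (Nat.card K : ℝ) ^ finrank K ↥(w.1 ⊓ x.1) + c) - c / (k - θ) * k := by
      rw [← h1, ← (h x).1, Finset.mul_sum, ← Finset.sum_sub_distrib]
      refine Finset.sum_congr rfl fun z _ => ?_
      rw [distanceMatrix_one_apply, kernelMatrix_apply, inf_comm w.1]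
      ring
    rw [h2, inf_comm w.1]
    field_simp
    ring
  refine ⟨c / (k - θ), hA, fun y => ?_⟩
  have h3 : ∑ x, (distanceMatrix (grassmannGraph K U D) 1 *
      kernelMatrix K U D (c / (k - θ))) x y = k * ∑ x, kernelMatrix K U D (c / (k - θ)) x y := by
    simp only [Matrix.mul_apply]
    rw [Finset.sum_comm, Finset.mul_sum]
    refine Finset.sum_congr rfl fun z _ => ?_
    rw [← Finset.sum_mul]
    congr 1
    rw [← (h z).1]
    refine Finset.sum_congr rfl fun x _ => ?_
    rw [distanceMatrix_one_apply, inf_comm]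
  rw [hA] at h3
  simp only [Matrix.smul_apply, smul_eq_mul] at h3
  rw [← Finset.mul_sum] at h3
  have : (k - θ) * ∑ x, kernelMatrix K U D (c / (k - θ)) x y = 0 := by linarith
  exact (mul_eq_zero.1 this).resolve_left hkθ

theorem kernelMatrix_mem_boseMesner (μ : ℝ) :
    kernelMatrix K U D μ ∈ boseMesner (grassmannGraph K U D) := by
  refine mem_boseMesner_of_forall fun x y x' y' h => ?_
  have h1 := grassmannGraph_dist_add x y
  have h2 := grassmannGraph_dist_add x' y'
  rw [kernelMatrix_apply, kernelMatrix_apply,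
    (by omega : finrank K ↥(x.1 ⊓ y.1) = finrank K ↥(x'.1 ⊓ y'.1))]

/-- Pairs of vertices at equal distance are equivalent under `GL(U)`, so entries of the square
depend only on the distance. -/
theorem kernelMatrix_mul_mem_boseMesner (μ : ℝ) :
    kernelMatrix K U D μ * kernelMatrix K U D μ ∈ boseMesner (grassmannGraph K U D) := by
  refine mem_boseMesner_of_forall fun x y x' y' h => ?_
  have h1 := grassmannGraph_dist_add x y
  have h2 := grassmannGraph_dist_add x' y'
  obtain ⟨e, hx, hy⟩ := exists_linearEquiv_map_pair rfl x.1 y.1 x'.1 y'.1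
    (x.2.trans x'.2.symm) (y.2.trans y'.2.symm) (by omega)
  refine Fintype.sum_equiv (vertexEquiv D e) _ _ fun z => ?_
  have e1 : finrank K ↥(x'.1 ⊓ (vertexEquiv D e z).1) = finrank K ↥(x.1 ⊓ z.1) := by
    rw [← hx]
    exact finrank_inf_map e _ _
  have e2 : finrank K ↥((vertexEquiv D e z).1 ⊓ y'.1) = finrank K ↥(z.1 ⊓ y.1) := by
    rw [← hy]
    exact finrank_inf_map e _ _
  simp only [kernelMatrix_apply]
  rw [e1, e2]

theorem kernelMatrix_ne_zero (hU : finrank K U = 2 * D) (hD : 0 < D) (μ : ℝ) :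
    kernelMatrix K U D μ ≠ 0 := by
  intro h
  obtain ⟨x, y, hxy⟩ := exists_vertex hU hD
  have h1 : kernelMatrix K U D μ x x = 0 := by rw [h]; rfl
  have h2 : kernelMatrix K U D μ x y = 0 := by rw [h]; rfl
  rw [kernelMatrix_apply] at h1 h2
  have h3 : (Nat.card K : ℝ) ^ finrank K ↥(x.1 ⊓ y.1) = (Nat.card K : ℝ) ^ finrank K ↥(x.1 ⊓ x.1) :=
    by linarith
  have h4 := pow_right_injective₀ (by linarith [one_lt_card_real K]) (one_lt_card_real K).ne' h3
  rw [inf_idem, x.2] at h4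
  exact hxy (vertex_eq_of_finrank_inf h4)

/-- Every matrix of the Bose-Mesner algebra with eigenvalue `θ₁` is a multiple of the kernel. -/
theorem exists_eq_smul_kernelMatrix (hU : finrank K U = 2 * D) (hD : 0 < D) {μ : ℝ}
    (hμ : distanceMatrix (grassmannGraph K U D) 1 * kernelMatrix K U D μ =
      grassmannEigenvalue (Nat.card K) D 1 • kernelMatrix K U D μ)
    {M : Matrix (GrassmannVertex K U D) (GrassmannVertex K U D) ℝ}
    (hM : M ∈ boseMesner (grassmannGraph K U D))
    (hθ : distanceMatrix (grassmannGraph K U D) 1 * M =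
      grassmannEigenvalue (Nat.card K) D 1 • M) : ∃ c : ℝ, M = c • kernelMatrix K U D μ := by
  have hG := grassmannGraph_connected hU hD
  have hB := kernelMatrix_mem_boseMesner (K := K) (U := U) (D := D) μ
  obtain ⟨x, -⟩ := exists_vertex hU hD
  have h0 : kernelMatrix K U D μ x x ≠ 0 := fun h =>
    kernelMatrix_ne_zero hU hD μ (eq_zero_of_mem_boseMesner hG hB hμ h)
  refine ⟨M x x / kernelMatrix K U D μ x x, sub_eq_zero.1 ?_⟩
  refine eq_zero_of_mem_boseMesner hG (θ := grassmannEigenvalue (Nat.card K) D 1) (x₀ := x)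
    (sub_mem hM (Submodule.smul_mem _ _ hB)) ?_ ?_
  · rw [mul_sub, Matrix.mul_smul, hμ, hθ, smul_sub, smul_comm]
  · simp [h0]

/-- The square is again an eigenmatrix for `θ₁` in the algebra, hence a multiple of the kernel. By
symmetry its diagonal entries are sums of squares, so the multiple is nonzero. -/
theorem exists_kernelMatrix_mul_self (hU : finrank K U = 2 * D) (hD : 0 < D) {μ : ℝ}
    (hμ : distanceMatrix (grassmannGraph K U D) 1 * kernelMatrix K U D μ =
      grassmannEigenvalue (Nat.card K) D 1 • kernelMatrix K U D μ) :
    ∃ t : ℝ, t ≠ 0 ∧ kernelMatrix K U D μ * kernelMatrix K U D μ = t • kernelMatrix K U D μ := by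
  obtain ⟨t, ht⟩ := exists_eq_smul_kernelMatrix hU hD hμ (kernelMatrix_mul_mem_boseMesner μ)
    (by rw [← Matrix.mul_assoc, hμ, Matrix.smul_mul])
  refine ⟨t, fun h0 => kernelMatrix_ne_zero hU hD μ ?_, ht⟩
  rw [h0, zero_smul] at ht
  ext x y
  have h1 := congrFun (congrFun ht x) x
  rw [Matrix.mul_apply, Matrix.zero_apply, Finset.sum_eq_zero_iff_of_nonneg] at h1
  · have h2 := h1 y (Finset.mem_univ _)
    rw [kernelMatrix_comm μ y x] at h2
    exact mul_self_eq_zero.1 h2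
  · intro z _
    rw [kernelMatrix_comm μ z x]
    exact mul_self_nonneg _

/-- The primitive idempotent for `θ₁` exists and is unique. -/
theorem existsUnique_primitiveIdempotent (hU : finrank K U = 2 * D) (hD : 0 < D) :
    ∃! E : Matrix (GrassmannVertex K U D) (GrassmannVertex K U D) ℝ,
      IsPrimitiveIdempotent (grassmannGraph K U D) E ∧
        distanceMatrix (grassmannGraph K U D) 1 * E =
          grassmannEigenvalue (Nat.card K) D 1 • E := by
  obtain ⟨μ, hμ, -⟩ := exists_kernelMatrix_eigen hU hD
  obtain ⟨t, ht0, ht⟩ := exists_kernelMatrix_mul_self hU hD hμ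
  have hB0 := kernelMatrix_ne_zero (K := K) (U := U) hU hD μ
  have huniq : ∀ F ∈ boseMesner (grassmannGraph K U D), F * F = F →
      distanceMatrix (grassmannGraph K U D) 1 * F = grassmannEigenvalue (Nat.card K) D 1 • F →
      F = 0 ∨ F = t⁻¹ • kernelMatrix K U D μ := by
    intro F hF hFF hθ
    obtain ⟨c, rfl⟩ := exists_eq_smul_kernelMatrix hU hD hμ hF hθ
    rw [Matrix.smul_mul, Matrix.mul_smul, ht, smul_smul, smul_smul] at hFF
    have h1 := smul_left_injective ℝ hB0 hFF
    by_cases hc : c = 0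
    · left
      rw [hc, zero_smul]
    · right
      congr 1
      field_simp
      have : c * (c * t - 1) = 0 := by linear_combination h1
      linear_combination (mul_eq_zero.1 this).resolve_left hc
  have hA : distanceMatrix (grassmannGraph K U D) 1 * (t⁻¹ • kernelMatrix K U D μ) =
      grassmannEigenvalue (Nat.card K) D 1 • (t⁻¹ • kernelMatrix K U D μ) := by
    rw [Matrix.mul_smul, hμ, smul_comm]
  refine ⟨t⁻¹ • kernelMatrix K U D μ, ⟨⟨?_, ?_, ?_, ?_⟩, hA⟩, ?_⟩
  · exact Submodule.smul_mem _ _ (kernelMatrix_mem_boseMesner μ)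
  · exact smul_ne_zero (inv_ne_zero ht0) hB0
  · rw [Matrix.smul_mul, Matrix.mul_smul, ht, inv_smul_smul₀ ht0]
  · intro F hF hFF hEF _
    -- An idempotent below this one inherits the eigenvalue, which gives minimality.
    refine huniq F hF hFF ?_
    rw [← hEF, ← Matrix.mul_assoc, hA, Matrix.smul_mul]
  · rintro F ⟨⟨hF, hF0, hFF, -⟩, hθ⟩
    exact (huniq F hF hFF hθ).resolve_left hF0

end PrimitiveIdempotent

/-! ### Neighbour sums without the extra direction -/

section NeighborRelation

variable {K U : Type*} [Field K] [Finite K] [AddCommGroup U] [Module K U] [FiniteDimensional K U]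
  {D : ℕ}

/-- The weighted neighbour sum whose kernel transform only involves `x` and `y`. -/
theorem exists_kernelSum_neighborWeight (hU : finrank K U = 2 * D) {x y : GrassmannVertex K U D}
    {r j : ℕ} (hr : finrank K ↥(x.1 ⊓ y.1) = r) (hr0 : 0 < r) (hj : r + j + 1 = D)
    {Q : ℝ} (hQ : Q = Nat.card K) :
    ∃ κ : ℝ, ∀ w : GrassmannVertex K U D,
      kernelSum (biradial (neighborWeight D r ((Q ^ j - 1) / (Q ^ D - Q ^ (j + 1)))) x y) w.1 =
        (Q ^ j - 1) / (Q - 1) * ((Q ^ D - Q) / (Q - 1)) * Q ^ finrank K ↥(w.1 ⊓ x.1) +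
          Q ^ j * Q ^ finrank K ↥(w.1 ⊓ y.1) + κ := by
  obtain ⟨R, hR⟩ : ∃ R : ℝ, R = Q ^ r := ⟨_, rfl⟩
  obtain ⟨J, hJ⟩ : ∃ J : ℝ, J = Q ^ j := ⟨_, rfl⟩
  have hI : Q * J = Q ^ (j + 1) := by rw [hJ, pow_succ']
  have hX : Q ^ D = R * (Q * J) := by rw [hI, hR, ← pow_add, ← hj, add_assoc]
  have hQ1 : 1 < Q := hQ ▸ one_lt_card_real K
  have hQ0 : 0 < Q - 1 := by linarith
  have hR1 : 0 < R - 1 := by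
    have : 1 < R := hR ▸ one_lt_pow₀ hQ1 hr0.ne'
    linarith
  have hJ0 : 0 < J := hJ ▸ by positivity
  have hR0 : 0 < R := by linarith
  have hQp : 0 < Q := by linarith
  rw [hX, ← hJ, ← hI]
  have hXI : R * (Q * J) - Q * J = Q * J * (R - 1) := by ring
  obtain ⟨m, a, b, s, o, H⟩ := exists_hasClassValues
    (neighborWeight D r ((J - 1) / (R * (Q * J) - Q * J))) x y
  obtain ⟨⟨ha, hb, hs⟩, ho⟩ := H.neighborWeight_values hU hr hj hQ hR hI hJ
    -- The weight times the number of farther neighbours. The weight is chosen to make `s = o`, so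
    -- the coefficient of `x ⊔ y`, and by duality that of `x ⊓ y`, vanishes.
    (T := (J - 1) * (Q ^ 2 * J * (R - 1)) / (Q - 1) ^ 2) (by
      rw [hXI]
      field_simp)
  have hdual := H.inf_coeff_eq hU (by omega) (by omega)
  have hs' : s = (J - 1) / (Q - 1) := by
    field_simp
    exact hs
  have hb' : b = (Q * J - 1) / (Q - 1) := by
    field_simp
    exact hb
  have ho' : o = (J - 1) / (Q - 1) := by
    have h0 : (R * (Q * J)) ^ 2 - R * (Q * J) * (Q * J) ≠ 0 := by
      have : (R * (Q * J)) ^ 2 - R * (Q * J) * (Q * J) = R * (Q * J) ^ 2 * (R - 1) := by ring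
      rw [this]
      positivity
    refine mul_right_cancel₀ h0 ?_
    rw [ho]
    field_simp
  have ha' : a = ((Q * J - 1) * (J - 1) + (J - 1) * (Q * J * (R - 1))) / (Q - 1) ^ 2 := by
    rw [eq_div_iff (by positivity), ha]
    field_simp
  have hso : s - o = 0 := by rw [hs', ho', sub_self]
  rw [hso, mul_zero] at hdual
  refine ⟨o * Q ^ D + (vectorSum (biradial (neighborWeight D r
    ((J - 1) / (R * (Q * J) - Q * J))) x y) 0 - m), fun w => ?_⟩
  rw [H.kernelSum_eq, hdual, hso, w.2, ← hQ]
  have h1 : a - s = (J - 1) / (Q - 1) * ((R * (Q * J) - Q) / (Q - 1)) := by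
    rw [ha', hs']
    field_simp
    ring
  have h2 : b - s = J := by
    rw [hb', hs']
    field_simp
    ring
  rw [h1, h2]
  ring

/-- The neighbour sum at distance `D`. -/
theorem exists_kernelSum_neighborWeight_opposite (hU : finrank K U = 2 * D)
    {x y : GrassmannVertex K U D} {j : ℕ} (hr : finrank K ↥(x.1 ⊓ y.1) = 0) (hj : j + 1 = D)
    {Q : ℝ} (hQ : Q = Nat.card K) :
    ∃ κ : ℝ, ∀ w : GrassmannVertex K U D,
      kernelSum (biradial (neighborWeight D 0 0) x y) w.1 =
        Q * ((Q ^ j - 1) / (Q - 1)) ^ 2 * Q ^ finrank K ↥(w.1 ⊓ x.1) +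
          Q ^ j * Q ^ finrank K ↥(w.1 ⊓ y.1) + κ := by
  obtain ⟨J, hJ⟩ : ∃ J : ℝ, J = Q ^ j := ⟨_, rfl⟩
  have hI : Q * J = Q ^ (j + 1) := by rw [hJ, pow_succ']
  have hQ1 : 1 < Q := hQ ▸ one_lt_card_real K
  have hQ0 : 0 < Q - 1 := by linarith
  have hQp : 0 < Q := by linarith
  rw [← hJ]
  obtain ⟨m, a, b, s, o, H⟩ := exists_hasClassValues (neighborWeight D 0 0) x y
  obtain ⟨⟨ha, hb, hs⟩, -⟩ := H.neighborWeight_values hU hr (by omega) hQ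
    (pow_zero Q).symm hI hJ (T := 0) (by ring)
  have hs' : s = (J - 1) / (Q - 1) := by
    field_simp
    exact hs
  have hb' : b = (Q * J - 1) / (Q - 1) := by
    field_simp
    exact hb
  have ha' : a = ((Q * J - 1) * (J - 1)) / (Q - 1) ^ 2 := by
    rw [eq_div_iff (by positivity), ha]
    ring
  have hxy : x.1 ⊓ y.1 = ⊥ := Submodule.finrank_eq_zero.1 hr
  have htop : x.1 ⊔ y.1 = ⊤ := by
    refine Submodule.eq_top_of_finrank_eq ?_
    have h3 := finrank_sup_add_inf x.1 y.1
    have hx := x.2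
    have hy := y.2
    omega
  refine ⟨(m - a - b + s) + (s - o) * Q ^ D + o * Q ^ D + (vectorSum (biradial
    (neighborWeight D 0 0) x y) 0 - m), fun w => ?_⟩
  -- The meet and join terms no longer depend on `w`, so `m` and `o` need not be computed.
  rw [H.kernelSum_eq, hxy, htop, inf_bot_eq, inf_top_eq, finrank_bot, w.2, ← hQ]
  have h1 : a - s = Q * ((J - 1) / (Q - 1)) ^ 2 := by
    rw [ha', hs']
    field_simp
    ring
  have h2 : b - s = J := by
    rw [hb', hs']
    field_simp
    ring
  rw [h1, h2]
  ring

end NeighborRelation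

/-! ### The extra direction of the Norton product -/

section NortonProduct

variable {K U : Type*} [Field K] [Finite K] [AddCommGroup U] [Module K U] [FiniteDimensional K U]
  {D : ℕ}

open Classical in
/-- The number of vertices containing the subspace `t` and the vector `u`. -/
noncomputable def countThrough (D : ℕ) (t : Submodule K U) (u : U) : ℝ :=
  ∑ z : GrassmannVertex K U D, if u ∈ z.1 ∧ t ≤ z.1 then 1 else 0

theorem countThrough_eq {t : Submodule K U} {u v : U} (hu : u ∉ t) (hv : v ∉ t) :
    countThrough D t u = countThrough D t v := by
  classical
  obtain ⟨e, rfl, he⟩ := exists_linearEquiv_apply_eq hu hv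
  have ht := map_eq_of_forall_mem (he t (.inl le_rfl)) rfl
  refine Fintype.sum_equiv (vertexEquiv D e) _ _ fun z => ?_
  have h1 : (e u ∈ (vertexEquiv D e z).1) = (u ∈ z.1) := by simp [vertexEquiv]
  have h2 : (t ≤ (vertexEquiv D e z).1) = (t ≤ z.1) := by
    conv_lhs => rw [← ht]
    exact propext (Submodule.map_le_map_iff_of_injective e.injective _ _)
  simp only [h1, h2]

theorem countThrough_le {t : Submodule K U} {u v : U} (hv : v ∉ t) :
    countThrough D t v ≤ countThrough D t u := by
  classical
  by_cases hu : u ∈ t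
  · refine Finset.sum_le_sum fun z _ => ?_
    by_cases h : t ≤ z.1
    · simp only [h hu, h, and_self, if_true, and_true]
      split_ifs <;> norm_num
    · rw [if_neg fun H => h H.2, if_neg fun H => h H.2]
  · exact (countThrough_eq hv hu).le

/-- Some vertex contains `t` but avoids `v`: take it inside a complement of the line of `v` that
contains `t`. -/
theorem countThrough_lt (hU : finrank K U = 2 * D) {t : Submodule K U}
    (ht : finrank K t ≤ D) (hD : 0 < D) {u v : U} (hu : u ∈ t) (hv : v ∉ t) :
    countThrough D t v < countThrough D t u := by
  classical
  have hv0 : v ≠ 0 := fun h => hv (h ▸ t.zero_mem)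
  have hd : Disjoint t (Submodule.span K {v}) := (Submodule.disjoint_span_singleton' hv0).2 hv
  obtain ⟨c, htc, hc⟩ := hd.exists_isCompl
  have h1 := Submodule.finrank_add_eq_of_isCompl hc
  rw [finrank_span_singleton hv0] at h1
  obtain ⟨z, htz, hzc, hz⟩ := exists_between_finrank_eq htc ht (by linarith)
  have hvz : v ∉ z := fun h => hv0 <| by
    have h2 : v ∈ c ⊓ Submodule.span K {v} := ⟨hzc h, Submodule.mem_span_singleton_self v⟩
    rwa [hc.inf_eq_bot, Submodule.mem_bot] at h2
  refine Finset.sum_lt_sum (fun z _ => ?_) ⟨⟨z, hz⟩, Finset.mem_univ _, ?_⟩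
  · by_cases h : t ≤ z.1
    · simp only [h hu, h, and_self, if_true, and_true]
      split_ifs <;> norm_num
    · rw [if_neg fun H => h H.2, if_neg fun H => h H.2]
  · rw [if_neg fun H => hvz H.1, if_pos ⟨htz hu, htz⟩]
    norm_num

open Classical in
-- The product of the two powers of `q` counts the pairs in `x × y` lying in `z`; summing over `z`
-- first counts vertices through a pair and `u`.
theorem vectorSum_mul_eq [Fintype U] (x y : GrassmannVertex K U D) (u : U) :
    vectorSum (biradial (fun k l => (Nat.card K : ℝ) ^ k * (Nat.card K : ℝ) ^ l) x y) u =
      ∑ p : U × U, if p.1 ∈ x.1 ∧ p.2 ∈ y.1 then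
        countThrough D (Submodule.span K {p.1, p.2}) u else 0 := by
  simp only [vectorSum, biradial, countThrough, ← sum_ite_mem]
  have h1 (z : GrassmannVertex K U D) :
      (if u ∈ z.1 then (∑ v : U, if v ∈ x.1 ⊓ z.1 then (1 : ℝ) else 0) *
        (∑ v : U, if v ∈ y.1 ⊓ z.1 then (1 : ℝ) else 0) else 0) =
      ∑ p : U × U, if p.1 ∈ x.1 ∧ p.2 ∈ y.1 then
        (if u ∈ z.1 ∧ Submodule.span K {p.1, p.2} ≤ z.1 then 1 else 0) else 0 := by
    rw [Finset.sum_mul_sum, ← Fintype.sum_prod_type', ← mul_one (∑ p : U × U, _), ← mul_ite_zero,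
      Finset.sum_mul]
    refine Finset.sum_congr rfl fun p _ => ?_
    rw [Submodule.span_le, Set.insert_subset_iff, Set.singleton_subset_iff]
    simp only [Submodule.mem_inf, SetLike.mem_coe]
    by_cases h1 : p.1 ∈ x.1 <;> by_cases h2 : p.2 ∈ y.1 <;> by_cases h3 : p.1 ∈ z.1 <;>
      by_cases h4 : p.2 ∈ z.1 <;> by_cases h5 : u ∈ z.1 <;> simp [h1, h2, h3, h4, h5]
  simp only [h1]
  rw [Finset.sum_comm]
  refine Finset.sum_congr rfl fun p _ => ?_
  split_ifs
  · rfl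
  · simp

/-- The Norton product really involves `x ⊓ y` and `x ⊔ y`. -/
theorem HasClassValues.out_lt_sup (hU : finrank K U = 2 * D) (hD : 2 ≤ D)
    {x y : GrassmannVertex K U D} (h0 : 0 < finrank K ↥(x.1 ⊓ y.1)) (hxy : x ≠ y)
    {C μ : ℝ} (hC : 0 < C) {m a b s o : ℝ}
    (H : HasClassValues x.1 y.1 (vectorSum (biradial (fun k l =>
      C * (((Nat.card K : ℝ) ^ k - μ) * ((Nat.card K : ℝ) ^ l - μ))) x y)) m a b s o) : o < s := by
  classical
  have : Finite U := Module.finite_of_finite K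
  let _ := Fintype.ofFinite U
  obtain ⟨d, hdy, hdx⟩ := exists_mem_notMem hxy
  obtain ⟨c, hcx, hcy⟩ := exists_mem_notMem hxy.symm
  have hx := x.2
  have hy := y.2
  have hux : c + d ∉ x.1 := by rwa [add_mem_cancel_left hcx]
  have huy : c + d ∉ y.1 := by rwa [add_mem_cancel_right hdy]
  have hus : c + d ∈ x.1 ⊔ y.1 :=
    add_mem (Submodule.mem_sup_left hcx) (Submodule.mem_sup_right hdy)
  obtain ⟨v, hv⟩ : ∃ v, v ∉ x.1 ⊔ y.1 := by
    by_contra! h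
    have h1 : x.1 ⊔ y.1 = ⊤ := Submodule.eq_top_iff'.2 h
    have h2 := finrank_sup_add_inf x.1 y.1
    rw [h1, finrank_top] at h2
    omega
  have hvx : v ∉ x.1 := fun h => hv (Submodule.mem_sup_left h)
  have hvy : v ∉ y.1 := fun h => hv (Submodule.mem_sup_right h)
  rw [← H.out v hv, ← H.sup _ hus hux huy]
  have expand (u : U) : vectorSum (biradial (fun k l =>
      C * (((Nat.card K : ℝ) ^ k - μ) * ((Nat.card K : ℝ) ^ l - μ))) x y) u =
      C * (vectorSum (biradial (fun k l => (Nat.card K : ℝ) ^ k * (Nat.card K : ℝ) ^ l) x y) u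
        - μ * vectorSum (biradial (fun k _ => (Nat.card K : ℝ) ^ k - μ) x x) u
        - μ * vectorSum (biradial (fun k _ => (Nat.card K : ℝ) ^ k) y y) u) := by
    simp only [vectorSum, biradial, Finset.mul_sum, ← Finset.sum_sub_distrib]
    refine Finset.sum_congr rfl fun z _ => ?_
    split_ifs <;> ring
  -- The terms involving only `x` or only `y` agree at `c + d` and `v`, which lie outside both
  -- subspaces; only the product term can differ.
  rw [expand, expand, vectorSum_biradial_eq _ hux hvx (.inl le_rfl) (.inl le_rfl),
    vectorSum_biradial_eq _ huy hvy (.inl le_rfl) (.inl le_rfl)]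
  have key : vectorSum (biradial (fun k l => (Nat.card K : ℝ) ^ k * (Nat.card K : ℝ) ^ l) x y) v <
      vectorSum (biradial (fun k l => (Nat.card K : ℝ) ^ k * (Nat.card K : ℝ) ^ l) x y) (c + d) := by
    rw [vectorSum_mul_eq, vectorSum_mul_eq]
    have hspan {p : U × U} (h1 : p.1 ∈ x.1) (h2 : p.2 ∈ y.1) :
        v ∉ Submodule.span K {p.1, p.2} := fun h => hv <| by
      refine (Submodule.span_le.2 ?_ : Submodule.span K {p.1, p.2} ≤ x.1 ⊔ y.1) h
      rw [Set.insert_subset_iff, Set.singleton_subset_iff]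
      exact ⟨Submodule.mem_sup_left h1, Submodule.mem_sup_right h2⟩
    -- No span of a pair contains `v`, so no pair favours it; the span of `(c, d)` contains `c + d`,
    -- which makes the inequality strict.
    refine Finset.sum_lt_sum (fun p _ => ?_) ⟨(c, d), Finset.mem_univ _, ?_⟩
    · split_ifs with h
      · exact countThrough_le (hspan h.1 h.2)
      · exact le_rfl
    · rw [if_pos ⟨hcx, hdy⟩, if_pos ⟨hcx, hdy⟩]
      refine countThrough_lt hU ?_ (by omega) ?_ (hspan (p := (c, d)) hcx hdy)
      · refine le_trans ?_ hD
        have := finrank_span_finset_le_card (R := K) ({c, d} : Finset U)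
        rw [Finset.coe_pair] at this
        exact this.trans Finset.card_le_two
      · exact add_mem (Submodule.subset_span (by simp)) (Submodule.subset_span (by simp))
  exact mul_lt_mul_of_pos_left (by linarith) hC

end NortonProduct

/-! ### The Norton-balanced condition and the main theorem -/

section NortonBalanced

variable {K U : Type*} [Field K] [Finite K] [AddCommGroup U] [Module K U] [FiniteDimensional K U]
  {D : ℕ}

open Classical in
theorem sum_hat_eq {X : Type*} [Fintype X] (p : X → Prop) [DecidablePred p] :
    ∑ z : X with p z, hat z = fun z => if p z then (1 : ℝ) else 0 := by
  ext w
  rw [Finset.sum_apply]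
  simp [hat, Pi.single_apply, Finset.sum_ite_eq]

theorem kernelSum_hat (x : GrassmannVertex K U D) (s : Submodule K U) :
    kernelSum (hat x) s = (Nat.card K : ℝ) ^ finrank K ↥(s ⊓ x.1) := by
  classical
  simp [kernelSum, hat, Pi.single_apply]

theorem kernelSum_add (g h : GrassmannVertex K U D → ℝ) (s : Submodule K U) :
    kernelSum (g + h) s = kernelSum g s + kernelSum h s := by
  simp [kernelSum, mul_add, Finset.sum_add_distrib]

theorem kernelSum_smul (c : ℝ) (h : GrassmannVertex K U D → ℝ) (s : Submodule K U) :
    kernelSum (c • h) s = c * kernelSum h s := by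
  simp only [kernelSum, Finset.mul_sum, Pi.smul_apply, smul_eq_mul]
  exact Finset.sum_congr rfl fun z _ => by ring

/-- The scalar multiples of the kernel with column sums zero. -/
structure IsCenteredKernel (E : Matrix (GrassmannVertex K U D) (GrassmannVertex K U D) ℝ)
    (c μ : ℝ) : Prop where
  eq : E = c • kernelMatrix K U D μ
  ne : c ≠ 0
  sum : ∀ y, ∑ x, kernelMatrix K U D μ x y = 0

theorem IsCenteredKernel.mulVec_apply
    {E : Matrix (GrassmannVertex K U D) (GrassmannVertex K U D) ℝ} {c μ : ℝ}
    (hE : IsCenteredKernel E c μ) (h : GrassmannVertex K U D → ℝ) (w : GrassmannVertex K U D) :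
    E.mulVec h w = c * (kernelSum h w.1 - μ * ∑ z, h z) := by
  rw [hE.eq, Matrix.smul_mulVec, Pi.smul_apply, kernelMatrix_mulVec, smul_eq_mul]

/-- Functions with constant kernel transform are annihilated. -/
theorem IsCenteredKernel.mulVec_eq_zero
    {E : Matrix (GrassmannVertex K U D) (GrassmannVertex K U D) ℝ} {c μ : ℝ}
    (hE : IsCenteredKernel E c μ) {h : GrassmannVertex K U D → ℝ} {κ : ℝ}
    (hκ : ∀ w : GrassmannVertex K U D, kernelSum h w.1 = κ) : E.mulVec h = 0 := by
  have h1 (w : GrassmannVertex K U D) : E.mulVec h w = c * (κ - μ * ∑ z, h z) := by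
    rw [hE.mulVec_apply, hκ]
  -- `E h` is a constant function, and the zero column sums of `E` make its total zero.
  have h2 : ∑ w, E.mulVec h w = 0 := by
    simp only [Matrix.mulVec, dotProduct]
    rw [Finset.sum_comm]
    refine Finset.sum_eq_zero fun z _ => ?_
    rw [← Finset.sum_mul, hE.eq]
    simp only [Matrix.smul_apply, ← Finset.smul_sum, hE.sum, smul_zero, zero_mul]
  simp only [h1, Finset.sum_const, nsmul_eq_mul] at h2
  ext w
  rw [h1, Pi.zero_apply]
  refine (mul_eq_zero.1 h2).resolve_left ?_
  have : Nonempty (GrassmannVertex K U D) := ⟨w⟩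
  simp

theorem IsCenteredKernel.mulVec_eq_add
    {E : Matrix (GrassmannVertex K U D) (GrassmannVertex K U D) ℝ} {c μ : ℝ}
    (hE : IsCenteredKernel E c μ) {h n : GrassmannVertex K U D → ℝ}
    {x y : GrassmannVertex K U D} {α β ν κ : ℝ}
    (hκ : ∀ w : GrassmannVertex K U D, kernelSum h w.1 =
      α * (Nat.card K : ℝ) ^ finrank K ↥(w.1 ⊓ x.1)
        + β * (Nat.card K : ℝ) ^ finrank K ↥(w.1 ⊓ y.1) + ν * kernelSum n w.1 + κ) :
    E.mulVec h = α • E.mulVec (hat x) + β • E.mulVec (hat y) + ν • E.mulVec n := by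
  have h1 := hE.mulVec_eq_zero (h := h + (-α) • hat x + (-β) • hat y + (-ν) • n) (κ := κ) fun w => by
    simp only [kernelSum_add, kernelSum_smul, kernelSum_hat, hκ]
    ring
  simp only [Matrix.mulVec_add, Matrix.mulVec_smul] at h1
  rw [← sub_eq_zero, ← h1]
  module

theorem sphereSum_eq_biradial (i j : ℕ) (x y : GrassmannVertex K U D) :
    sphereSum (grassmannGraph K U D) i j x y =
      biradial (fun k l => if D - k = i ∧ D - l = j then 1 else 0) x y := by
  rw [sphereSum, sum_hat_eq]
  ext z
  have h1 := grassmannGraph_dist_add x z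
  have h2 := grassmannGraph_dist_add y z
  simp only [biradial,
    (by omega : D - finrank K ↥(x.1 ⊓ z.1) = (grassmannGraph K U D).dist x z),
    (by omega : D - finrank K ↥(y.1 ⊓ z.1) = (grassmannGraph K U D).dist y z)]

theorem IsCenteredKernel.mul_eq_biradial
    {E : Matrix (GrassmannVertex K U D) (GrassmannVertex K U D) ℝ} {c μ : ℝ}
    (hE : IsCenteredKernel E c μ) (x y : GrassmannVertex K U D) :
    E.mulVec (hat x) * E.mulVec (hat y) = biradial (fun k l =>
      c ^ 2 * (((Nat.card K : ℝ) ^ k - μ) * ((Nat.card K : ℝ) ^ l - μ))) x y := by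
  have hs (x : GrassmannVertex K U D) : ∑ z, hat x z = 1 := by
    rw [Finset.sum_eq_single x (fun z _ hz => by simp [hat, hz]) (by simp)]
    simp [hat]
  ext z
  rw [Pi.mul_apply, hE.mulVec_apply, hE.mulVec_apply, kernelSum_hat, kernelSum_hat, hs, hs]
  simp only [biradial]
  rw [inf_comm z.1, inf_comm z.1]
  ring

theorem IsCenteredKernel.isNortonBalanced (hU : finrank K U = 2 * D) (hD : 2 ≤ D)
    {E : Matrix (GrassmannVertex K U D) (GrassmannVertex K U D) ℝ} {c μ : ℝ}
    (hE : IsCenteredKernel E c μ) : IsNortonBalanced (grassmannGraph K U D) E := by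
  intro x y i j
  rw [sphereSum_eq_biradial, nortonProduct, hE.mul_eq_biradial]
  suffices H : ∃ α β ν κ : ℝ, ∀ w : GrassmannVertex K U D,
      kernelSum (biradial (fun k l => if D - k = i ∧ D - l = j then 1 else 0) x y) w.1 =
      α * (Nat.card K : ℝ) ^ finrank K ↥(w.1 ⊓ x.1)
        + β * (Nat.card K : ℝ) ^ finrank K ↥(w.1 ⊓ y.1) + ν * kernelSum (biradial (fun k l =>
      c ^ 2 * (((Nat.card K : ℝ) ^ k - μ) * ((Nat.card K : ℝ) ^ l - μ))) x y) w.1 + κ by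
    obtain ⟨α, β, ν, κ, hκ⟩ := H
    rw [hE.mulVec_eq_add hκ]
    refine add_mem (add_mem ?_ ?_) ?_ <;>
    exact Submodule.smul_mem _ _ (Submodule.subset_span (by simp))
  obtain ⟨m, a, b, s, o, H⟩ :=
    exists_hasClassValues (fun k l => if D - k = i ∧ D - l = j then 1 else 0) x y
  have hw (w : GrassmannVertex K U D) : finrank K w.1 = D := w.2
  rcases eq_or_ne x y with rfl | hxy
  · refine ⟨m - o, 0, 0, o * (Nat.card K : ℝ) ^ D + (vectorSum (biradial
      (fun k l => if D - k = i ∧ D - l = j then 1 else 0) x x) 0 - m), fun w => ?_⟩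
    rw [H.kernelSum_eq, hw, inf_idem, sup_idem]
    ring
  have hx := x.2
  have hy := y.2
  have hsup := finrank_sup_add_inf x.1 y.1
  rcases Nat.eq_zero_or_pos (finrank K ↥(x.1 ⊓ y.1)) with h0 | h0
  · have hinf : x.1 ⊓ y.1 = ⊥ := Submodule.finrank_eq_zero.1 h0
    have htop : x.1 ⊔ y.1 = ⊤ := Submodule.eq_top_of_finrank_eq (by omega)
    refine ⟨a - s, b - s, 0, (m - a - b + s) + (s - o) * (Nat.card K : ℝ) ^ D
      + o * (Nat.card K : ℝ) ^ D + (vectorSum (biradial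
      (fun k l => if D - k = i ∧ D - l = j then 1 else 0) x y) 0 - m), fun w => ?_⟩
    rw [H.kernelSum_eq, hw, hinf, htop, inf_bot_eq, inf_top_eq, finrank_bot, hw]
    ring
  · obtain ⟨m', a', b', s', o', H'⟩ := exists_hasClassValues (fun k l =>
      c ^ 2 * (((Nat.card K : ℝ) ^ k - μ) * ((Nat.card K : ℝ) ^ l - μ))) x y
    have h1 : finrank K ↥(x.1 ⊓ y.1) < D :=
      lt_of_le_of_ne (finrank_inf_le x y) fun h => hxy (vertex_eq_of_finrank_inf h)
    have hlt := H'.out_lt_sup hU hD h0 hxy (by have := hE.ne; positivity)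
    have hne : s' - o' ≠ 0 := by linarith
    -- The multiple of the Norton product is fixed by matching the `x ⊔ y` coefficients. The `x ⊓ y`
    -- coefficients then match too, since duality gives both functions the same ratio.
    refine ⟨(a - s) - (s - o) / (s' - o') * (a' - s'), (b - s) - (s - o) / (s' - o') * (b' - s'),
      (s - o) / (s' - o'), o * (Nat.card K : ℝ) ^ D + (vectorSum (biradial
      (fun k l => if D - k = i ∧ D - l = j then 1 else 0) x y) 0 - m) -
      (s - o) / (s' - o') * (o' * (Nat.card K : ℝ) ^ D + (vectorSum (biradial (fun k l =>
      c ^ 2 * (((Nat.card K : ℝ) ^ k - μ) * ((Nat.card K : ℝ) ^ l - μ))) x y) 0 - m')),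
      fun w => ?_⟩
    rw [H.kernelSum_eq, H'.kernelSum_eq, hw, H.inf_coeff_eq hU h0 h1, H'.inf_coeff_eq hU h0 h1]
    field_simp
    ring

theorem xMinus_add_smul_xPlus {x y : GrassmannVertex K U D} {r : ℕ}
    (hr : finrank K ↥(x.1 ⊓ y.1) = r) (ρ : ℝ) :
    xMinus (grassmannGraph K U D) x y + ρ • xPlus (grassmannGraph K U D) x y =
      biradial (neighborWeight D r ρ) x y := by
  classical
  rw [xMinus, xPlus, sum_hat_eq, sum_hat_eq]
  ext z
  have h1 := grassmannGraph_dist_add x z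
  have h2 := grassmannGraph_dist_add y z
  have h3 := grassmannGraph_dist_add x y
  have e1 : ((grassmannGraph K U D).dist x z = 1 ∧
      (grassmannGraph K U D).dist y z + 1 = (grassmannGraph K U D).dist x y) ↔
      (finrank K ↥(x.1 ⊓ z.1) + 1 = D ∧ finrank K ↥(y.1 ⊓ z.1) = r + 1) := by omega
  have e2 : ((grassmannGraph K U D).dist x z = 1 ∧
      (grassmannGraph K U D).dist y z = (grassmannGraph K U D).dist x y + 1) ↔
      (finrank K ↥(x.1 ⊓ z.1) + 1 = D ∧ finrank K ↥(y.1 ⊓ z.1) + 1 = r) := by omega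
  simp only [Pi.add_apply, Pi.smul_apply, smul_eq_mul, biradial, neighborWeight, e1, e2]

theorem IsPrimitiveIdempotent.exists_isCenteredKernel (hU : finrank K U = 2 * D) (hD : 0 < D)
    {E : Matrix (GrassmannVertex K U D) (GrassmannVertex K U D) ℝ}
    (hE : IsPrimitiveIdempotent (grassmannGraph K U D) E)
    (hθ : distanceMatrix (grassmannGraph K U D) 1 * E =
      grassmannEigenvalue (Nat.card K) D 1 • E) : ∃ c μ, IsCenteredKernel E c μ := by
  obtain ⟨μ, hμ, hsum⟩ := exists_kernelMatrix_eigen (K := K) hU hD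
  obtain ⟨c, hc⟩ := exists_eq_smul_kernelMatrix hU hD hμ hE.1 hθ
  exact ⟨c, μ, hc, fun h => hE.2.1 (by rw [hc, h, zero_smul]), hsum⟩

end NortonBalanced

theorem mainTheorem9 (K U : Type*) [Field K] [Finite K] [AddCommGroup U] [Module K U]
    [FiniteDimensional K U] (D : ℕ) (hD : 3 ≤ D) (hU : Module.finrank K U = 2 * D)
    (q : ℝ) (hq : q = (Nat.card K : ℝ)) :
    (∃! E : Matrix (GrassmannVertex K U D) (GrassmannVertex K U D) ℝ,
      IsPrimitiveIdempotent (grassmannGraph K U D) E ∧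
        distanceMatrix (grassmannGraph K U D) 1 * E = grassmannEigenvalue q D 1 • E) ∧
    ∀ E : Matrix (GrassmannVertex K U D) (GrassmannVertex K U D) ℝ,
      IsPrimitiveIdempotent (grassmannGraph K U D) E →
      distanceMatrix (grassmannGraph K U D) 1 * E = grassmannEigenvalue q D 1 • E →
      IsNortonBalanced (grassmannGraph K U D) E ∧
      ∀ (x y : GrassmannVertex K U D) (i : ℕ), (grassmannGraph K U D).dist x y = i →
        (2 ≤ i → i ≤ D - 1 →
          0 = E.mulVec (xMinus (grassmannGraph K U D) x y)
            + ((q ^ (i - 1) - 1) / (q ^ D - q ^ i)) •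
                E.mulVec (xPlus (grassmannGraph K U D) x y)
            - ((q ^ (i - 1) - 1) / (q - 1) * ((q ^ D - q) / (q - 1))) • E.mulVec (hat x)
            - q ^ (i - 1) • E.mulVec (hat y)) ∧
        (i = D →
          0 = E.mulVec (xMinus (grassmannGraph K U D) x y)
            - (q * ((q ^ (D - 1) - 1) / (q - 1)) ^ 2) • E.mulVec (hat x)
            - q ^ (D - 1) • E.mulVec (hat y)) := by
  refine ⟨hq ▸ existsUnique_primitiveIdempotent hU (by omega), fun E hE hθ => ?_⟩
  obtain ⟨c, μ, hc⟩ := hE.exists_isCenteredKernel hU (by omega) (hq ▸ hθ)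
  refine ⟨hc.isNortonBalanced hU (by omega), fun x y i hi => ⟨fun h2 hiD => ?_, fun hiD => ?_⟩⟩
  · have hd := grassmannGraph_dist_add x y
    -- The bound `i ≤ D - 1` makes `x ⊓ y` nonzero, so the denominator `q ^ D - q ^ i` does not
    -- vanish.
    obtain ⟨j, rfl⟩ : ∃ j, i = j + 1 := ⟨i - 1, by omega⟩
    obtain ⟨κ, hκ⟩ := exists_kernelSum_neighborWeight hU (x := x) (y := y) rfl (by omega)
      (by omega : _ + j + 1 = D) hq
    rw [← xMinus_add_smul_xPlus rfl] at hκ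
    have h := hc.mulVec_eq_add (x := x) (y := y) (n := 0) (ν := 0) (κ := κ)
      (α := (q ^ j - 1) / (q - 1) * ((q ^ D - q) / (q - 1))) (β := q ^ j) fun w => by
        rw [hκ w, hq]
        ring
    rw [Matrix.mulVec_add, Matrix.mulVec_smul, Matrix.mulVec_zero, smul_zero, add_zero] at h
    rw [Nat.add_sub_cancel, h]
    abel
  · have hd := grassmannGraph_dist_add x y
    have h0 : finrank K ↥(x.1 ⊓ y.1) = 0 := by omega
    obtain ⟨κ, hκ⟩ := exists_kernelSum_neighborWeight_opposite hU (x := x) (y := y) h0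
      (by omega : D - 1 + 1 = D) hq
    rw [← xMinus_add_smul_xPlus h0, zero_smul, add_zero] at hκ
    have h := hc.mulVec_eq_add (x := x) (y := y) (n := 0) (ν := 0) (κ := κ)
      (α := q * ((q ^ (D - 1) - 1) / (q - 1)) ^ 2) (β := q ^ (D - 1)) fun w => by
        rw [hκ w, hq]
        ring
    rw [Matrix.mulVec_zero, smul_zero, add_zero] at h
    rw [h]
    abel
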